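/- **Setting.** Let $\mathbb H^n=\mathbb R^{2n}\times\mathbb R$ be the Heisenberg group with product $(z,t)\cdot(z',t')=(z+z',\,t+t'+\omega(z,z'))$, $\omega(z,z')=\frac12\sum_{i=1}^n(z_iz'_{n+i}-z_{n+i}z'_i)$, Korányi norm $\|(z,t)\|=(|z|^4+16t^2)^{1/4}$ and distance $d(x,y)=\|y^{-1}\cdot x\|$. Diameters, closed balls $B(x,r)$ and Hausdorff measures $\mathcal H^k$ are taken with respect to $d$, and the distance to the empty set is $\infty$. Let $1\le k\le n$. A *$k$-dimensional horizontal subgroup* is $V=V_I\times\{0\}$ with $V_I\subset\mathbb R^{2n}$ a $k$-dimensional linear subspace on which $\omega$ vanishes; $P_V(z,t)=(\pi_{V_I}(z),0)$ with $\pi_{V_I}$ the orthogonal projection; $W=V_I^\perp\times\mathbb R$ and $P_W(y)=P_V(y)^{-1}\cdot y$. An *affine horizontal $k$-plane* is a set $x\cdot V$ with $x\in\mathbb H^n$; $P_{x\cdot V}(y)=x\cdot P_V(x^{-1}\cdot y)$. A *$k$-dimensional intrinsic Lipschitz graph with constant at most $L$* is a set $\Gamma=\Phi(V)$, $\Phi(v)=v\cdot\phi(v)$,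 with $V$ a $k$-dimensional horizontal subgroup and $\phi:V\to W$ such that $\|P_W(\Phi(v')^{-1}\Phi(v))\|\le L\|P_V(\Phi(v')^{-1}\Phi(v))\|$ for all $v,v'\in V$. A set $E\subset\mathbb H^n$ is *$k$-regular* if it is closed and there is $C_E>1$ with $C_E^{-1}r^k\le\mathcal H^k(E\cap B(x,r))\le C_Er^k$ for all $x\in E$ and $0<r\le\operatorname{diam}E$, $r<\infty$. A *dyadic system* on $E$ (with constants $\varrho\in(0,1)$, $D>1$) is a collection $\mathcal D=\bigcup_{j\in\mathbb J}\mathcal D_j$, where $\mathbb J=\mathbb Z$ if $E$ is unbounded and $\mathbb J=\{j\ge J_0\}$ with $\varrho^{J_0+1}\le\operatorname{diam}E<\varrho^{J_0}$ otherwise, each $\mathcal D_j$ is a family of pairwise disjoint Borel sets with union $E$, any two intersecting elements of $\mathcal D$ are nested, and for all $j\in\mathbb J$, $Q\in\mathcal D_j$: $D^{-1}\varrho^j\le\operatorname{diam}Q\le D\varrho^j$; $D^{-1}\varrho^{jk}\le\mathcal H^k(Q)\le D\varrho^{jk}$; $B(x_Q,D^{-1}\varrho^j)\cap E\subset Q$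 for some $x_Q\in E$; and $\mathcal H^k(\{x\in Q:d(x,E\setminus Q)\le\eta\varrho^j\})\le D\eta^{1/D}\mathcal H^k(Q)$ for all $\eta>0$. The children of $Q\in\mathcal D_j$ are the $R\in\mathcal D_{j+1}$ with $R\subset Q$. For $\lambda>1$, $\lambda Q=\{x\in E:d(x,Q)\le(\lambda-1)\operatorname{diam}Q\}$. A *coronization with constant $C$* is a disjoint decomposition $\mathcal D=\mathcal G\,\dot\cup\,\mathcal B$ together with a partition $\mathcal F$ of $\mathcal G$ into trees $\mathcal S$ such that, for every $R\in\mathcal D$, $\sum_{Q\in\mathcal B,\,Q\subseteq R}\mathcal H^k(Q)\le C\mathcal H^k(R)$ and $\sum_{\mathcal S\in\mathcal F,\,Q(\mathcal S)\subseteq R}\mathcal H^k(Q(\mathcal S))\le C\mathcal H^k(R)$, and every $\mathcal S\in\mathcal F$ is coherent: it has an element $Q(\mathcal S)$ containing all its other elements; if $Q\in\mathcal S$, $Q'\in\mathcal D$ and $Q\subseteq Q'\subseteq Q(\mathcal S)$, then $Q'\in\mathcal S$; and for each $Q\in\mathcal S$ either all children of $Q$ belong to $\mathcal S$ or none of them does.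 Put $h_{\mathcal S}(x)=\inf\{d(x,Q)+\operatorname{diam}Q:Q\in\mathcal S\}$. Let $\mathcal D$ be a dyadic system on the $k$-regular set $E$ and let $K_0\ge2$. * *(P-C)*: for every $\eta>0$ there are $C=C(\eta)>0$ and a coronization of $\mathcal D$ with constant $C$ such that for each $\mathcal S\in\mathcal F$ there is an affine horizontal $k$-plane $V_{\mathcal S}$ with $$d(x,y)\le(1+2\eta)\,d(P_{V_{\mathcal S}}(x),P_{V_{\mathcal S}}(y))$$ for all $x,y\in K_0Q(\mathcal S)$ with $d(x,y)>\eta\min\{h_{\mathcal S}(x),h_{\mathcal S}(y)\}$. * *(ILG-C)*: for every $\eta>0$ there are $C=C(\eta)>0$ and a coronization of $\mathcal D$ with constant $C$ such that for each $\mathcal S\in\mathcal F$ there is a $k$-dimensional intrinsic Lipschitz graph $\Gamma_{\mathcal S}$ with constant at most $\eta$ such that, for all $Q\in\mathcal S$, $d(x,\Gamma_{\mathcal S})\le\eta\operatorname{diam}(Q)$ whenever $x\in E$ and $d(x,Q)\le\operatorname{diam}(Q)$. **Theorem.** Let $1\le k\le n$, let $E\subset\mathbb H^n$ be $k$-regular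 with a dyadic system $\mathcal D$, and let $K_0\ge2$. Then $E$ satisfies (P-C) if and only if $E$ satisfies (ILG-C), both with respect to $\mathcal D$. -/

import Mathlib

open MeasureTheory Set
open scoped ENNReal

/-! ## The Heisenberg group with the Korányi distance -/

/-- The `n`-th Heisenberg group, with underlying set `ℝ²ⁿ × ℝ`. A point is written `(z, t)`. The
`2n` coordinates of `z` are indexed by `Fin n ⊕ Fin n`: `z (Sum.inl i)` is the `i`-th coordinate
and `z (Sum.inr i)` is the `(n + i)`-th coordinate. -/
@[ext]
structure Heis (n : ℕ) where
  z : EuclideanSpace ℝ (Fin n ⊕ Fin n)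
  t : ℝ

namespace Heis

variable {n : ℕ}

/-- The form `ω(z, z') = ½ ∑ᵢ (zᵢ z'ₙ₊ᵢ - zₙ₊ᵢ z'ᵢ)`. -/
noncomputable def omega (z w : EuclideanSpace ℝ (Fin n ⊕ Fin n)) : ℝ :=
  (1 / 2) * ∑ i : Fin n, (z (Sum.inl i) * w (Sum.inr i) - z (Sum.inr i) * w (Sum.inl i))

theorem omega_add_left (z z' w : EuclideanSpace ℝ (Fin n ⊕ Fin n)) :
    omega (z + z') w = omega z w + omega z' w := by
  simp only [omega, PiLp.add_apply, ← mul_add, ← Finset.sum_add_distrib]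
  congr 1
  exact Finset.sum_congr rfl fun i _ => by ring

theorem omega_add_right (z w w' : EuclideanSpace ℝ (Fin n ⊕ Fin n)) :
    omega z (w + w') = omega z w + omega z w' := by
  simp only [omega, PiLp.add_apply, ← mul_add, ← Finset.sum_add_distrib]
  congr 1
  exact Finset.sum_congr rfl fun i _ => by ring

theorem omega_neg_left (z w : EuclideanSpace ℝ (Fin n ⊕ Fin n)) :
    omega (-z) w = -omega z w := by
  simp only [omega, PiLp.neg_apply, ← mul_neg, ← Finset.sum_neg_distrib]
  congr 1
  exact Finset.sum_congr rfl fun i _ => by ring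

theorem omega_self (z : EuclideanSpace ℝ (Fin n ⊕ Fin n)) : omega z z = 0 := by
  have h : ∀ i : Fin n, z (Sum.inl i) * z (Sum.inr i) - z (Sum.inr i) * z (Sum.inl i) = 0 :=
    fun i => by ring
  simp [omega, h]

/-- The group law `(z, t) · (z', t') = (z + z', t + t' + ω(z, z'))`. -/
noncomputable instance : Mul (Heis n) := ⟨fun p q => ⟨p.z + q.z, p.t + q.t + omega p.z q.z⟩⟩

noncomputable instance : One (Heis n) := ⟨⟨0, 0⟩⟩

noncomputable instance : Inv (Heis n) := ⟨fun p => ⟨-p.z, -p.t⟩⟩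

@[simp] theorem mul_z (p q : Heis n) : (p * q).z = p.z + q.z := rfl
@[simp] theorem mul_t (p q : Heis n) : (p * q).t = p.t + q.t + omega p.z q.z := rfl
@[simp] theorem one_z : (1 : Heis n).z = 0 := rfl
@[simp] theorem one_t : (1 : Heis n).t = 0 := rfl
@[simp] theorem inv_z (p : Heis n) : (p⁻¹).z = -p.z := rfl
@[simp] theorem inv_t (p : Heis n) : (p⁻¹).t = -p.t := rfl

noncomputable instance : Group (Heis n) :=
  Group.ofLeftAxioms
    (fun p q r => by
      ext1
      · simp [add_assoc]
      · simp only [mul_t, mul_z, omega_add_left, omega_add_right]; ring)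
    (fun p => by
      ext1
      · simp
      · simp [omega])
    (fun p => by
      ext1
      · simp
      · simp [omega_neg_left, omega_self])

/-- The Korányi norm `‖(z, t)‖ = (|z|⁴ + 16 t²)^(1/4)`. -/
noncomputable def koranyi (p : Heis n) : ℝ := (‖p.z‖ ^ 4 + 16 * p.t ^ 2) ^ (1 / 4 : ℝ)

theorem koranyi_nonneg (p : Heis n) : 0 ≤ koranyi p := by
  unfold koranyi; positivity

theorem koranyi_pow (p : Heis n) : koranyi p ^ 4 = ‖p.z‖ ^ 4 + 16 * p.t ^ 2 := by
  unfold koranyi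
  rw [← Real.rpow_natCast, ← Real.rpow_mul (by positivity)]
  norm_num

theorem koranyi_one : koranyi (1 : Heis n) = 0 := by
  simp [koranyi]

theorem koranyi_inv (p : Heis n) : koranyi p⁻¹ = koranyi p := by
  simp [koranyi]

theorem eq_one_of_koranyi (p : Heis n) (h : koranyi p = 0) : p = 1 := by
  have h4 := koranyi_pow p
  rw [h] at h4
  have hz : ‖p.z‖ ^ 4 = 0 := by nlinarith [sq_nonneg p.t, sq_nonneg (‖p.z‖ ^ 2)]
  have ht : p.t ^ 2 = 0 := by nlinarith [sq_nonneg p.t, sq_nonneg (‖p.z‖ ^ 2)]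
  ext1
  · simpa using hz
  · simpa using ht

theorem norm_z_le (p : Heis n) : ‖p.z‖ ≤ koranyi p := by
  refine le_of_pow_le_pow_left₀ (n := 4) (by norm_num) (koranyi_nonneg p) ?_
  rw [koranyi_pow]
  nlinarith [sq_nonneg p.t]

theorem norm_sq_eq (z : EuclideanSpace ℝ (Fin n ⊕ Fin n)) :
    ‖z‖ ^ 2 = ∑ i : Fin n, ‖(⟨z (Sum.inl i), z (Sum.inr i)⟩ : ℂ)‖ ^ 2 := by
  rw [EuclideanSpace.real_norm_sq_eq, Fintype.sum_sum_type, ← Finset.sum_add_distrib]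
  refine Finset.sum_congr rfl fun i _ => ?_
  rw [Complex.sq_norm, Complex.normSq_mk]; ring

theorem inner_omega_le (z w : EuclideanSpace ℝ (Fin n ⊕ Fin n)) :
    ‖(⟨inner ℝ z w, 2 * omega z w⟩ : ℂ)‖ ≤ ‖z‖ * ‖w‖ := by
  have e : (⟨inner ℝ z w, 2 * omega z w⟩ : ℂ) = ∑ i : Fin n,
      (starRingEnd ℂ) (⟨z (Sum.inl i), z (Sum.inr i)⟩ : ℂ) *
        (⟨w (Sum.inl i), w (Sum.inr i)⟩ : ℂ) := by
    apply Complex.ext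
    · rw [Complex.re_sum]
      change inner ℝ z w = _
      rw [PiLp.inner_apply, Fintype.sum_sum_type, ← Finset.sum_add_distrib]
      refine Finset.sum_congr rfl fun i _ => ?_
      simp; ring
    · rw [Complex.im_sum]
      simp only [omega]
      rw [← mul_assoc, show (2 : ℝ) * (1 / 2) = 1 by norm_num, one_mul]
      refine Finset.sum_congr rfl fun i _ => ?_
      simp; ring
  rw [e]
  refine (norm_sum_le _ _).trans ?_
  refine le_of_pow_le_pow_left₀ (n := 2) (by norm_num) (by positivity) ?_
  rw [mul_pow, norm_sq_eq z, norm_sq_eq w]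
  simp only [norm_mul, RCLike.norm_conj]
  exact Finset.sum_mul_sq_le_sq_mul_sq _ _ _

theorem koranyi_sq (p : Heis n) : koranyi p ^ 2 = ‖(⟨‖p.z‖ ^ 2, 4 * p.t⟩ : ℂ)‖ := by
  rw [← sq_eq_sq₀ (by positivity) (by positivity), Complex.sq_norm, Complex.normSq_mk]
  have := koranyi_pow p
  nlinarith

theorem koranyi_mul_le (p q : Heis n) : koranyi (p * q) ≤ koranyi p + koranyi q := by
  have hp := koranyi_nonneg p
  have hq := koranyi_nonneg q
  refine le_of_pow_le_pow_left₀ (n := 2) (by norm_num) (by positivity) ?_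
  have e : (⟨‖(p * q).z‖ ^ 2, 4 * (p * q).t⟩ : ℂ) =
      ⟨‖p.z‖ ^ 2, 4 * p.t⟩ + ⟨‖q.z‖ ^ 2, 4 * q.t⟩ +
        2 * ⟨inner ℝ p.z q.z, 2 * omega p.z q.z⟩ := by
    apply Complex.ext
    · simp [norm_add_sq_real]; ring
    · simp; ring
  rw [koranyi_sq, e]
  refine (norm_add₃_le).trans ?_
  rw [← koranyi_sq, ← koranyi_sq, norm_mul]
  have h1 := inner_omega_le p.z q.z
  have h2 : ‖p.z‖ * ‖q.z‖ ≤ koranyi p * koranyi q :=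
    mul_le_mul (norm_z_le p) (norm_z_le q) (norm_nonneg _) hp
  have h3 : ‖(2 : ℂ)‖ = 2 := by norm_num
  rw [h3]
  nlinarith

/-- The Korányi distance `d(x, y) = ‖y⁻¹ · x‖`. -/
noncomputable instance : MetricSpace (Heis n) where
  dist x y := koranyi (y⁻¹ * x)
  dist_self x := by simp [koranyi_one]
  dist_comm x y := by
    rw [← koranyi_inv]
    simp
  dist_triangle x y w := by
    have h := koranyi_mul_le (w⁻¹ * y) (y⁻¹ * x)
    rw [show w⁻¹ * y * (y⁻¹ * x) = w⁻¹ * x by group] at h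
    linarith
  eq_of_dist_eq_zero {x y} h := by
    have h1 := eq_one_of_koranyi _ h
    rw [inv_mul_eq_one] at h1
    exact h1.symm

theorem dist_def (x y : Heis n) : dist x y = koranyi (y⁻¹ * x) := rfl

/-- The Borel sigma-algebra. -/
noncomputable instance : MeasurableSpace (Heis n) := borel _

instance : BorelSpace (Heis n) := ⟨rfl⟩

/-! ## Horizontal subgroups, projections, intrinsic Lipschitz graphs -/

/-- `V` is a `k`-dimensional isotropic subspace of `ℝ²ⁿ`; the `k`-dimensional horizontal subgroups
are exactly the sets `V × {0}` for such `V`, see `horizontalSubgroup`. -/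
def IsIsotropic (k : ℕ) (V : Submodule ℝ (EuclideanSpace ℝ (Fin n ⊕ Fin n))) : Prop :=
  Module.finrank ℝ V = k ∧ ∀ z ∈ V, ∀ w ∈ V, omega z w = 0

/-- The set `V × {0}`. -/
def horizontalSubgroup (V : Submodule ℝ (EuclideanSpace ℝ (Fin n ⊕ Fin n))) : Set (Heis n) :=
  {p | p.z ∈ V ∧ p.t = 0}

/-- The Euclidean orthogonal complement `Vᗮ × ℝ` of `V × {0}` in `ℝ²ⁿ⁺¹`. -/
def verticalSubgroup (V : Submodule ℝ (EuclideanSpace ℝ (Fin n ⊕ Fin n))) : Set (Heis n) :=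
  {p | p.z ∈ Vᗮ}

/-- The horizontal projection `(z, t) ↦ (π_V(z), 0)` onto `V × {0}`. -/
noncomputable def projH (V : Submodule ℝ (EuclideanSpace ℝ (Fin n ⊕ Fin n))) (p : Heis n) :
    Heis n :=
  ⟨V.starProjection p.z, 0⟩

/-- The vertical projection `y ↦ (P_V(y))⁻¹ · y` onto `Vᗮ × ℝ`. -/
noncomputable def projW (V : Submodule ℝ (EuclideanSpace ℝ (Fin n ⊕ Fin n))) (p : Heis n) :
    Heis n :=
  (projH V p)⁻¹ * p

/-- The horizontal projection `y ↦ x · P_V(x⁻¹ · y)` onto the affine horizontal plane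
`x · (V × {0})`. -/
noncomputable def projAffine (x : Heis n)
    (V : Submodule ℝ (EuclideanSpace ℝ (Fin n ⊕ Fin n))) (y : Heis n) : Heis n :=
  x * projH V (x⁻¹ * y)

/-- The graph map `Φ(v) = v · φ(v)`. -/
noncomputable def graphMap {V : Submodule ℝ (EuclideanSpace ℝ (Fin n ⊕ Fin n))}
    (φ : horizontalSubgroup V → verticalSubgroup V) (v : horizontalSubgroup V) : Heis n :=
  (v : Heis n) * (φ v : Heis n)

/-- `φ` satisfies the intrinsic Lipschitz inequality with constant `L`. -/
def IntrinsicLipschitzWith (L : ℝ) {V : Submodule ℝ (EuclideanSpace ℝ (Fin n ⊕ Fin n))}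
    (φ : horizontalSubgroup V → verticalSubgroup V) : Prop :=
  ∀ v v' : horizontalSubgroup V,
    koranyi (projW V ((graphMap φ v')⁻¹ * graphMap φ v)) ≤
      L * koranyi (projH V ((graphMap φ v')⁻¹ * graphMap φ v))

/-- `Γ` is a `k`-dimensional intrinsic Lipschitz graph with intrinsic Lipschitz constant at most
`L`. (The best constant is attained, so it is at most `L > 0` if and only if the inequality holds
with `L`.) -/
def IsIntrinsicLipschitzGraph (k : ℕ) (L : ℝ) (Γ : Set (Heis n)) : Prop :=
  ∃ V : Submodule ℝ (EuclideanSpace ℝ (Fin n ⊕ Fin n)), IsIsotropic k V ∧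
    ∃ φ : horizontalSubgroup V → verticalSubgroup V,
      IntrinsicLipschitzWith L φ ∧ Γ = range (graphMap φ)

/-! ## Regular sets and dyadic systems -/

/-- `E` is (Ahlfors-David) `s`-regular with respect to the Korányi distance. -/
def IsRegular (s : ℝ) (E : Set (Heis n)) : Prop :=
  IsClosed E ∧ ∃ C : ℝ, 1 < C ∧ ∀ x ∈ E, ∀ r : ℝ, 0 < r → ENNReal.ofReal r ≤ Metric.ediam E →
    ENNReal.ofReal (C⁻¹ * r ^ s) ≤ μH[s] (E ∩ Metric.closedBall x r) ∧
      μH[s] (E ∩ Metric.closedBall x r) ≤ ENNReal.ofReal (C * r ^ s)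

/-- A system of dyadic cubes on a set `E` of dimension `k`. The cubes of generation `j` are the
elements of `gen j`, where `j` ranges over the index set `J`; the values `gen j` for `j ∉ J` play
no role. -/
structure DyadicSystem (k : ℕ) (E : Set (Heis n)) where
  ρ : ℝ
  D : ℝ
  ρ_pos : 0 < ρ
  ρ_lt_one : ρ < 1
  one_lt_D : 1 < D
  J : Set ℤ
  J_of_unbounded : ¬ Bornology.IsBounded E → J = univ
  J_of_bounded : Bornology.IsBounded E →
    ∃ J₀ : ℤ, ρ ^ (J₀ + 1) ≤ Metric.diam E ∧ Metric.diam E < ρ ^ J₀ ∧ J = Ici J₀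
  gen : ℤ → Set (Set (Heis n))
  measurable : ∀ j ∈ J, ∀ Q ∈ gen j, MeasurableSet Q
  pairwise_disjoint : ∀ j ∈ J, (gen j).PairwiseDisjoint id
  cover : ∀ j ∈ J, ⋃₀ gen j = E
  nested : ∀ i ∈ J, ∀ j ∈ J, ∀ Q ∈ gen i, ∀ R ∈ gen j, (Q ∩ R).Nonempty → Q ⊆ R ∨ R ⊆ Q
  diam_le : ∀ j ∈ J, ∀ Q ∈ gen j, Metric.ediam Q ≤ ENNReal.ofReal (D * ρ ^ j)
  le_diam : ∀ j ∈ J, ∀ Q ∈ gen j, ENNReal.ofReal (D⁻¹ * ρ ^ j) ≤ Metric.ediam Q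
  ball_subset : ∀ j ∈ J, ∀ Q ∈ gen j, ∃ x ∈ E, Metric.closedBall x (D⁻¹ * ρ ^ j) ∩ E ⊆ Q
  measure_le : ∀ j ∈ J, ∀ Q ∈ gen j, μH[(k : ℝ)] Q ≤ ENNReal.ofReal (D * (ρ ^ j) ^ k)
  le_measure : ∀ j ∈ J, ∀ Q ∈ gen j, ENNReal.ofReal (D⁻¹ * (ρ ^ j) ^ k) ≤ μH[(k : ℝ)] Q
  /-- Here the distance to the empty set is `∞`. -/
  small_boundary : ∀ j ∈ J, ∀ Q ∈ gen j, ∀ η : ℝ, 0 < η →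
    μH[(k : ℝ)] {x ∈ Q | Metric.infEDist x (E \ Q) ≤ ENNReal.ofReal (η * ρ ^ j)} ≤
      ENNReal.ofReal (D * η ^ (1 / D)) * μH[(k : ℝ)] Q

/-- The collection of all dyadic cubes. -/
def DyadicSystem.cubes {k : ℕ} {E : Set (Heis n)} (𝒟 : DyadicSystem k E) : Set (Set (Heis n)) :=
  {Q | ∃ j ∈ 𝒟.J, Q ∈ 𝒟.gen j}

/-- The enlarged cube `c Q = {x ∈ E : d(x, Q) ≤ (c - 1) diam Q}`. -/
def enlarge (E : Set (Heis n)) (c : ℝ) (Q : Set (Heis n)) : Set (Heis n) :=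
  {x ∈ E | Metric.infDist x Q ≤ (c - 1) * Metric.diam Q}

/-! ## Coronizations -/

/-- The union of all cubes of a family `S`. If `S` has a maximal element containing all others,
this is that element, see `treeTop_eq`. -/
def treeTop (S : Set (Set (Heis n))) : Set (Heis n) := ⋃₀ S

theorem treeTop_eq {S : Set (Set (Heis n))} {Q : Set (Heis n)} (h : IsGreatest S Q) :
    treeTop S = Q :=
  Subset.antisymm (sUnion_subset fun _ hR => h.2 hR) (subset_sUnion_of_mem h.1)

/-- Coherent families of cubes (trees). -/
structure IsCoherent {k : ℕ} {E : Set (Heis n)} (𝒟 : DyadicSystem k E)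
    (S : Set (Set (Heis n))) : Prop where
  subset : S ⊆ 𝒟.cubes
  /-- The tree contains a cube that contains all other cubes of the tree. -/
  top : IsGreatest S (treeTop S)
  convex : ∀ Q ∈ S, ∀ R ∈ 𝒟.cubes, Q ⊆ R → R ⊆ treeTop S → R ∈ S
  /-- Either all children of a cube of the tree lie in the tree, or none of them do. -/
  children : ∀ j ∈ 𝒟.J, ∀ Q ∈ 𝒟.gen j, Q ∈ S →
    (∀ R ∈ 𝒟.gen (j + 1), R ⊆ Q → R ∈ S) ∨ (∀ R ∈ 𝒟.gen (j + 1), R ⊆ Q → R ∉ S)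

/-- `good`, `bad` and `forest` form a coronization with constant `C`. -/
structure IsCoronization {k : ℕ} {E : Set (Heis n)} (𝒟 : DyadicSystem k E) (C : ℝ)
    (good bad : Set (Set (Heis n))) (forest : Set (Set (Set (Heis n)))) : Prop where
  union : good ∪ bad = 𝒟.cubes
  disjoint : Disjoint good bad
  bad_packing : ∀ R ∈ 𝒟.cubes,
    ∑' Q : {Q : Set (Heis n) // Q ∈ bad ∧ Q ⊆ R}, μH[(k : ℝ)] (Q : Set (Heis n)) ≤
      ENNReal.ofReal C * μH[(k : ℝ)] R
  forest_union : ⋃₀ forest = good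
  forest_disjoint : forest.PairwiseDisjoint id
  coherent : ∀ S ∈ forest, IsCoherent 𝒟 S
  top_packing : ∀ R ∈ 𝒟.cubes,
    ∑' S : {S : Set (Set (Heis n)) // S ∈ forest ∧ treeTop S ⊆ R},
        μH[(k : ℝ)] (treeTop (S : Set (Set (Heis n)))) ≤
      ENNReal.ofReal C * μH[(k : ℝ)] R

/-- The function `h_S(x) = inf {d(x, Q) + diam Q : Q ∈ S}`. -/
noncomputable def treeDist (S : Set (Set (Heis n))) (x : Heis n) : ℝ :=
  ⨅ Q : S, (Metric.infDist x (Q : Set (Heis n)) + Metric.diam (Q : Set (Heis n)))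

/-- Corona decomposition by intrinsic Lipschitz graphs with small constants (ILG-C), for the
dyadic system `𝒟` on `E`. -/
def CoronaILG (k : ℕ) (E : Set (Heis n)) (𝒟 : DyadicSystem k E) : Prop :=
  ∀ η : ℝ, 0 < η → ∃ C : ℝ, 0 < C ∧
    ∃ (good bad : Set (Set (Heis n))) (forest : Set (Set (Set (Heis n)))),
      IsCoronization 𝒟 C good bad forest ∧
      ∀ S ∈ forest, ∃ Γ : Set (Heis n), IsIntrinsicLipschitzGraph k η Γ ∧
        ∀ Q ∈ S, ∀ x ∈ E, Metric.infDist x Q ≤ Metric.diam Q →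
          Metric.infDist x Γ ≤ η * Metric.diam Q

/-- Corona decomposition by horizontal planes (P-C) with enlargement constant `K₀`, for the dyadic
system `𝒟` on `E`. The affine horizontal plane of the tree `S` is `p · (V × {0})`. -/
def CoronaPlanes (k : ℕ) (K₀ : ℝ) (E : Set (Heis n)) (𝒟 : DyadicSystem k E) : Prop :=
  ∀ η : ℝ, 0 < η → ∃ C : ℝ, 0 < C ∧
    ∃ (good bad : Set (Set (Heis n))) (forest : Set (Set (Set (Heis n)))),
      IsCoronization 𝒟 C good bad forest ∧
      ∀ S ∈ forest, ∃ (p : Heis n) (V : Submodule ℝ (EuclideanSpace ℝ (Fin n ⊕ Fin n))),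
        IsIsotropic k V ∧
        ∀ x ∈ enlarge E K₀ (treeTop S), ∀ y ∈ enlarge E K₀ (treeTop S),
          η * min (treeDist S x) (treeDist S y) < dist x y →
            dist x y ≤ (1 + 2 * η) * dist (projAffine p V x) (projAffine p V y)

end Heis

/-!
A horizontal graph over an isotropic subspace `V` of dimension `k` is described by three functions
on `V`. Write the point of the graph over `v` as `(v + w, s + ω(v, w))` with `w ∈ Vᗮ`, and split
`w = q + J g`, where `J` is the complex structure, `g ∈ V`, and `q` is orthogonal to `V ⊕ J V`. The
graph has a small intrinsic Lipschitz constant exactly when `g` and `q` have small Lipschitz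
constants and

  `|s(v) - s(v') - ⟨g(v'), v - v'⟩ - ω(q(v'), q(v))| ≤ ε |v - v'|²`

with small `ε` (`graphPoint_vertical`): up to the symplectic correction, `s` is of class `C^{1,1}`
with gradient `g`.

From planes to graphs. On a net of `K₀ Q(S)` that is separated at the scale `η h_S`, the projection
to `V` almost preserves distances, so the net is a horizontal graph with small constant over a
subset of `V`. This graph extends to all of `V`
(`exists_intrinsicLipschitzGraph_superset`), and the extension approximates `E` because the net is
dense at the scale `η h_S`. The extension is Whitney's: `q` and the affine functions
`s(a) + ⟨g(a), v - a⟩` are averaged with a Whitney partition of unity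
(`exists_whitneyPartition`), and the gradient is read off from the result
(`exists_horizontalJet_extension`). The symplectic corrections cancel in the average because
`ω(q, q) = 0`. Only the second order error has to be estimated, since on the whole of `V` it
controls the Lipschitz constant of the gradient (`norm_sub_le_of_jetError`). The constants depend on
`V` only through its dimension.

From graphs to planes. If `x` and `y` are close to an intrinsic Lipschitz graph with small constant,
relative to `d(x, y)`, then the projection to the horizontal subgroup of the graph almost preserves
their distance (`dist_le_of_infDist_graph_le`). A tree contains a cube of diameter about
`d(x, y) / η` that witnesses this closeness (`IsCoherent.exists_ancestor`), provided that
`K₀ Q(S)` lies in the region where the graph is known to approximate `E`. To arrange this, the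
cubes of each tree that are comparable to its top become bad, and the tree is replaced by the trees
below its maximal remaining cubes. This keeps the packing conditions
(`IsCoronization.exists_refinement`), since comparable nested cubes belong to boundedly many
generations.
-/

/-! ### Separated nets with variable scale -/

/-- A set has a subset that is separated at the variable scale `h` and dense at the same scale. -/
theorem exists_separated_net {X : Type*} [MetricSpace X] (s : Set X) (h : X → ℝ)
    (hh : ∀ x, 0 ≤ h x) :
    ∃ N ⊆ s, (∀ x ∈ N, ∀ y ∈ N, x ≠ y → min (h x) (h y) < dist x y) ∧
      ∀ x ∈ s, ∃ y ∈ N, dist x y ≤ min (h x) (h y) := by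
  let r : X → X → Prop := fun x y => min (h x) (h y) < dist x y
  have hr : Std.Symm r := ⟨fun x y hxy => by simpa [r, or_comm, dist_comm] using hxy⟩
  obtain ⟨N, hN⟩ := zorn_subset {N : Set X | N ⊆ s ∧ N.Pairwise r} (by
    intro c hc hchain
    refine ⟨⋃₀ c, ⟨sUnion_subset fun t ht => (hc ht).1, ?_⟩, fun t ht => subset_sUnion_of_mem ht⟩
    rw [pairwise_sUnion hchain.directedOn]
    exact fun t ht => (hc ht).2)
  refine ⟨N, hN.prop.1, fun x hx y hy hxy => hN.prop.2 hx hy hxy, fun x hx => ?_⟩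
  by_contra! hcon
  have hins : insert x N ∈ {N : Set X | N ⊆ s ∧ N.Pairwise r} :=
    ⟨insert_subset hx hN.prop.1,
      (pairwise_insert_of_symm (r := r)).2 ⟨hN.prop.2, fun b hb _ => hcon b hb⟩⟩
  have hxN : x ∈ N := hN.le_of_ge hins (subset_insert x N) (mem_insert x N)
  have := hcon x hxN
  rw [dist_self, min_self] at this
  exact absurd this (not_lt.2 (hh x))

/-! ### A Whitney partition of unity of class `C^{1,1}` -/

section Whitney

variable {F : Type*} [NormedAddCommGroup F]

/-- The bump `(1 - |y|²)₊²`, a function of class `C^{1,1}` supported in the closed unit ball. -/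
noncomputable def bump (y : F) : ℝ := (max 0 (1 - ‖y‖ ^ 2)) ^ 2

theorem bump_nonneg (y : F) : 0 ≤ bump y := by unfold bump; positivity

theorem norm_lt_one_of_bump_ne_zero {y : F} (h : bump y ≠ 0) : ‖y‖ < 1 := by
  by_contra! hy
  apply h
  unfold bump
  rw [max_eq_left (by nlinarith)]
  norm_num

theorem bump_lower_bound {y : F} (h : ‖y‖ ≤ 3 / 4) : 1 / 6 ≤ bump y := by
  unfold bump
  have h1 : 7 / 16 ≤ max 0 (1 - ‖y‖ ^ 2) :=
    le_max_of_le_right (by nlinarith [norm_nonneg y])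
  nlinarith

variable [InnerProductSpace ℝ F]

/-- The gradient of `bump`. -/
noncomputable def bumpGrad (y : F) : F := (-4 * max 0 (1 - ‖y‖ ^ 2)) • y

theorem norm_bumpGrad_le {y : F} (hy : ‖y‖ ≤ 3 / 2) : ‖bumpGrad y‖ ≤ 6 := by
  unfold bumpGrad
  have h1 : max 0 (1 - ‖y‖ ^ 2) ≤ 1 := max_le zero_le_one (by nlinarith [norm_nonneg y])
  have h0 : 0 ≤ max 0 (1 - ‖y‖ ^ 2) := le_max_left _ _
  rw [norm_smul, Real.norm_eq_abs, abs_mul, abs_of_nonneg h0]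
  norm_num
  nlinarith [norm_nonneg y]

theorem abs_bump_sub_sub_le {y h : F} (hy : ‖y‖ ≤ 3 / 2) (hh : ‖h‖ ≤ 1) :
    |bump (y + h) - bump y - inner ℝ (bumpGrad y) h| ≤ 18 * ‖h‖ ^ 2 := by
  unfold bump bumpGrad
  rw [real_inner_smul_left]
  have hsq : ‖y + h‖ ^ 2 = ‖y‖ ^ 2 + 2 * inner ℝ y h + ‖h‖ ^ 2 := norm_add_sq_real y h
  have hin : |inner ℝ y h| ≤ 3 / 2 * ‖h‖ :=
    (abs_real_inner_le_norm y h).trans (by gcongr)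
  rw [hsq]
  have h0 := norm_nonneg h
  have hy0 := norm_nonneg y
  set H := ‖h‖
  set I := inner ℝ y h
  set a := 1 - ‖y‖ ^ 2 with ha
  have hb : 1 - (‖y‖ ^ 2 + 2 * I + H ^ 2) = a - 2 * I - H ^ 2 := by rw [ha]; ring
  have ha1 : a ≤ 1 := by rw [ha]; nlinarith
  rw [hb]
  set d := -2 * I - H ^ 2 with hd
  have hdabs : |d| ≤ 4 * H := by
    rw [hd]
    rw [abs_le] at hin ⊢
    constructor <;> nlinarith
  have hd2 : d ^ 2 ≤ 16 * H ^ 2 := by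
    have := sq_le_sq' (abs_le.1 hdabs).1 (abs_le.1 hdabs).2
    nlinarith
  -- the square of the positive part has a quadratic Taylor remainder
  have key : |max 0 (a + d) ^ 2 - max 0 a ^ 2 - 2 * max 0 a * d| ≤ d ^ 2 := by
    rw [abs_le]
    rcases max_cases 0 (a + d) with ⟨h1, h2⟩ | ⟨h1, h2⟩ <;>
    rcases max_cases 0 a with ⟨h3, h4⟩ | ⟨h3, h4⟩ <;> rw [h1, h3] <;> constructor <;> nlinarith
  have hm0 : 0 ≤ max 0 a := le_max_left _ _
  have hm1 : max 0 a ≤ 1 := max_le zero_le_one ha1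
  have e : a - 2 * I - H ^ 2 = a + d := by rw [hd]; ring
  rw [e]
  have hI : -4 * max 0 a * I = 2 * max 0 a * d + 2 * max 0 a * H ^ 2 := by rw [hd]; ring
  rw [hI]
  rw [abs_le] at key ⊢
  have hp : 0 ≤ max 0 a * H ^ 2 := by positivity
  have hq : max 0 a * H ^ 2 ≤ H ^ 2 := by nlinarith [sq_nonneg H]
  constructor <;> nlinarith

/-- Taylor estimate for the quotient of a nonnegative term by the total sum. -/
theorem quotient_taylor {ι : Type*} (I : Finset ι) (f f₀ l : ι → ℝ) {K M t : ℝ} (hK : 1 ≤ K)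
    (hM : 1 ≤ M) (ht : 0 ≤ t) (ht1 : t ≤ 1) (hcard : (I.card : ℝ) ≤ M)
    (hf₀ : ∀ i ∈ I, 0 ≤ f₀ i)
    (hrem : ∀ i ∈ I, |f i - f₀ i - l i| ≤ K * t ^ 2) (hl : ∀ i ∈ I, |l i| ≤ K * t)
    (hΘ : 1 / 6 ≤ ∑ i ∈ I, f i) (hΘ₀ : 1 / 6 ≤ ∑ i ∈ I, f₀ i) :
    ∀ i ∈ I, |f i / ∑ i ∈ I, f i - f₀ i / ∑ i ∈ I, f₀ i -
      (l i - f₀ i / (∑ i ∈ I, f₀ i) * ∑ i ∈ I, l i) / ∑ i ∈ I, f₀ i| ≤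
        156 * M ^ 2 * K ^ 2 * t ^ 2 := by
  intro i hi
  have hsum : ∀ (g : ι → ℝ) (c : ℝ), 0 ≤ c → (∀ i ∈ I, |g i| ≤ c) → |∑ i ∈ I, g i| ≤ M * c := by
    intro g c hc hg
    calc |∑ i ∈ I, g i| ≤ ∑ i ∈ I, |g i| := Finset.abs_sum_le_sum_abs _ _
      _ ≤ I.card • c := Finset.sum_le_card_nsmul _ _ _ hg
      _ = I.card * c := by rw [nsmul_eq_mul]
      _ ≤ M * c := by gcongr
  have hS := hsum l (K * t) (by positivity) hl
  have hR := hsum (fun i => f i - f₀ i - l i) (K * t ^ 2) (by positivity) hrem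
  rw [Finset.sum_sub_distrib, Finset.sum_sub_distrib] at hR
  have hle : f₀ i ≤ ∑ i ∈ I, f₀ i := Finset.single_le_sum hf₀ hi
  set Θ := ∑ i ∈ I, f i
  set Θ₀ := ∑ i ∈ I, f₀ i
  set S := ∑ i ∈ I, l i
  have hΘp : 0 < Θ := by linarith
  have hΘ₀p : 0 < Θ₀ := by linarith
  set p := f₀ i / Θ₀ with hp
  have hp0 : 0 ≤ p := div_nonneg (hf₀ i hi) hΘ₀p.le
  have hp1 : p ≤ 1 := (div_le_one hΘ₀p).2 hle
  have hpm : f₀ i = p * Θ₀ := by rw [hp]; field_simp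
  have hMK : K * t ^ 2 ≤ M * (K * t ^ 2) := le_mul_of_one_le_left (by positivity) hM
  have hMK' : K * t ≤ M * (K * t) := le_mul_of_one_le_left (by positivity) hM
  have ht2 : t ^ 2 ≤ t := by nlinarith
  have hMt : M * (K * t ^ 2) ≤ M * (K * t) := by gcongr
  have hri := hrem i hi
  have hli := hl i hi
  -- the numerator and the linear part
  have hN : |(f i - p * Θ) - (l i - p * S)| ≤ 2 * (M * (K * t ^ 2)) := by
    have e : (f i - p * Θ) - (l i - p * S) = (f i - f₀ i - l i) - p * (Θ - Θ₀ - S) := by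
      rw [hpm]; ring
    rw [e]
    calc _ ≤ |f i - f₀ i - l i| + |p * (Θ - Θ₀ - S)| := abs_sub _ _
      _ ≤ K * t ^ 2 + 1 * (M * (K * t ^ 2)) := by
          rw [abs_mul, abs_of_nonneg hp0]; gcongr
      _ ≤ _ := by linarith
  have hL : |l i - p * S| ≤ 2 * (M * (K * t)) := by
    calc _ ≤ |l i| + |p * S| := abs_sub _ _
      _ ≤ K * t + 1 * (M * (K * t)) := by rw [abs_mul, abs_of_nonneg hp0]; gcongr
      _ ≤ _ := by linarith
  have hΔ : |Θ₀ - Θ| ≤ 2 * (M * (K * t)) := by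
    have e : Θ₀ - Θ = -(Θ - Θ₀ - S) - S := by ring
    rw [e]
    calc _ ≤ |-(Θ - Θ₀ - S)| + |S| := abs_sub _ _
      _ ≤ _ := by rw [abs_neg]; linarith
  have hinv : |1 / Θ| ≤ 6 := by
    rw [abs_of_pos (by positivity), div_le_iff₀ hΘp]; linarith
  have hinv₀ : |1 / Θ₀| ≤ 6 := by
    rw [abs_of_pos (by positivity), div_le_iff₀ hΘ₀p]; linarith
  have e : f i / Θ - p - (l i - p * S) / Θ₀ =
      ((f i - p * Θ) - (l i - p * S)) * (1 / Θ) +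
        (l i - p * S) * (Θ₀ - Θ) * (1 / Θ) * (1 / Θ₀) := by
    field_simp; ring
  rw [e]
  calc _ ≤ |(f i - p * Θ) - (l i - p * S)| * |1 / Θ| +
        |l i - p * S| * |Θ₀ - Θ| * |1 / Θ| * |1 / Θ₀| := by
          refine (abs_add_le _ _).trans ?_
          simp only [abs_mul, le_refl]
    _ ≤ 2 * (M * (K * t ^ 2)) * 6 + 2 * (M * (K * t)) * (2 * (M * (K * t))) * 6 * 6 := by
          gcongr
    _ = (12 * (M * K) + 144 * (M * K) ^ 2) * t ^ 2 := by ring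
    _ ≤ _ := by
          have : 1 ≤ M * K := one_le_mul_of_one_le_of_one_le hM hK
          have h2 : M * K ≤ (M * K) ^ 2 := by nlinarith
          calc _ ≤ (12 * (M * K) ^ 2 + 144 * (M * K) ^ 2) * t ^ 2 := by gcongr
            _ = _ := by ring

/-- A Whitney partition of unity `(ψ u)` on the complement of the closed set `A`, with constant `K`.
Indices are points of `F`. The finite set `I v` contains all indices that are active near `v`, and
the `C^{1,1}` bounds at scale `d(v, A)` are stated for the sums over `I v`. -/
structure WhitneyPartition (A : Set F) (K : ℝ) where
  ψ : F → F → ℝ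
  /-- The gradient of `ψ u`. -/
  m : F → F → F
  I : F → Finset F
  /-- A point of `A` close to the support of `ψ u`. -/
  near : F → F
  near_mem : ∀ u, near u ∈ A
  dist_near : ∀ v ∉ A, ∀ u ∈ I v, dist v (near u) ≤ 2 * Metric.infDist v A
  nonneg : ∀ u v, 0 ≤ ψ u v
  eq_zero : ∀ v ∉ A, ∀ w, dist w v ≤ Metric.infDist v A / 100 → ∀ u ∉ I v, ψ u w = 0
  sum_eq_one : ∀ v ∉ A, ∀ w, dist w v ≤ Metric.infDist v A / 100 → ∑ u ∈ I v, ψ u w = 1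
  taylor : ∀ v ∉ A, ∀ w, dist w v ≤ Metric.infDist v A / 100 →
    ∑ u ∈ I v, |ψ u w - ψ u v - inner ℝ (m u v) (w - v)| ≤
      K * (dist w v / Metric.infDist v A) ^ 2
  grad : ∀ v ∉ A, ∑ u ∈ I v, ‖m u v‖ ≤ K / Metric.infDist v A

/-- The complement of a closed set has a Whitney partition of unity whose constant depends only on
the dimension. -/
theorem exists_whitneyPartition [FiniteDimensional ℝ F] {A : Set F} (hA : IsClosed A)
    (hne : A.Nonempty) {M : ℝ} (hM : M = 5 ^ Module.finrank ℝ F) :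
    Nonempty (WhitneyPartition A (156 * M ^ 3 * 3600 ^ 2)) := by
  classical
  set δ : F → ℝ := fun v => Metric.infDist v A with hδdef
  have hδ0 : ∀ v, 0 ≤ δ v := fun v => Metric.infDist_nonneg
  have hδpos : ∀ v ∉ A, 0 < δ v := fun v hv => (hA.notMem_iff_infDist_pos hne).1 hv
  have hδlip : ∀ v w, δ v ≤ δ w + dist v w := fun v w => Metric.infDist_le_infDist_add_dist
  have hM1 : 1 ≤ M := by rw [hM]; exact one_le_pow₀ (by norm_num)
  choose a haA had using fun u : F => hA.exists_infDist_eq_dist hne u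
  obtain ⟨N, hNA, hNsep, hNnet⟩ := exists_separated_net Aᶜ (fun v => δ v / 16)
    (fun v => by have := hδ0 v; positivity)
  -- Points of the net within `δ v / 9` of `v` are `δ v / 18` separated, so the volume bound for
  -- `1`-separated sets in a ball of radius `2` applies.
  have hcard : ∀ v ∉ A, ∀ T : Finset F, (∀ u ∈ T, u ∈ N ∧ dist u v ≤ δ v / 9) →
      T.card ≤ 5 ^ Module.finrank ℝ F := by
    intro v hv T hT
    have hd := hδpos v hv
    let e : F → F := fun u => (18 / δ v) • (u - v)
    have hee : ∀ x y, e x - e y = (18 / δ v) • (x - y) := fun x y => by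
      simp only [e, ← smul_sub]; congr 1; abel
    have hinj : Function.Injective e := by
      intro x y hxy
      have := hee x y
      rw [hxy, sub_self] at this
      have h2 := smul_eq_zero.1 this.symm
      rcases h2 with h2 | h2
      · exact absurd h2 (by positivity)
      · exact sub_eq_zero.1 h2
    rw [← Finset.card_image_of_injective T hinj]
    apply Besicovitch.card_le_of_separated
    · intro c hc
      obtain ⟨u, hu, rfl⟩ := Finset.mem_image.1 hc
      have h := (hT u hu).2
      rw [dist_eq_norm] at h
      simp only [e, norm_smul, Real.norm_eq_abs, abs_of_pos (show 0 < 18 / δ v by positivity)]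
      calc 18 / δ v * ‖u - v‖ ≤ 18 / δ v * (δ v / 9) := by gcongr
        _ = 2 := by field_simp; norm_num
    · intro c hc d hd' hcd
      obtain ⟨x, hx, rfl⟩ := Finset.mem_image.1 hc
      obtain ⟨y, hy, rfl⟩ := Finset.mem_image.1 hd'
      have hxy : x ≠ y := fun h => hcd (by rw [h])
      have h := hNsep x (hT x hx).1 y (hT y hy).1 hxy
      have h1 : δ v / 18 ≤ δ x / 16 := by
        have := hδlip v x; have h2 := (hT x hx).2; rw [dist_comm] at h2; linarith
      have h2 : δ v / 18 ≤ δ y / 16 := by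
        have := hδlip v y; have h2 := (hT y hy).2; rw [dist_comm] at h2; linarith
      have h3 : δ v / 18 ≤ ‖x - y‖ := by
        rw [← dist_eq_norm]; exact (le_min h1 h2).trans h.le
      rw [hee, norm_smul, Real.norm_eq_abs, abs_of_pos (show 0 < 18 / δ v by positivity)]
      calc (1 : ℝ) = 18 / δ v * (δ v / 18) := by field_simp
        _ ≤ _ := by gcongr
  have hfin : ∀ v ∉ A, {u | u ∈ N ∧ dist u v ≤ δ v / 9}.Finite := by
    intro v hv
    by_contra hinf
    obtain ⟨T, hT, hTc⟩ := Set.Infinite.exists_subset_card_eq hinf (5 ^ Module.finrank ℝ F + 1)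
    have := hcard v hv T (fun u hu => hT hu)
    omega
  let I : F → Finset F := fun v => if hv : v ∉ A then (hfin v hv).toFinset else ∅
  have hI : ∀ v ∉ A, ∀ u, u ∈ I v ↔ u ∈ N ∧ dist u v ≤ δ v / 9 := by
    intro v hv u
    simp only [I, dif_pos hv, Set.Finite.mem_toFinset, mem_ofPred_eq]
  -- The bump of `u` is positive within `δ u / 12`, while the net is dense at the smaller scale
  -- `δ u / 16`, so some bump is bounded below at every point.
  let f : F → F → ℝ := fun u v => if u ∈ N then bump ((12 / δ u) • (v - u)) else 0
  let l : F → F → F := fun u v => (12 / δ u) • bumpGrad ((12 / δ u) • (v - u))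
  have hf0 : ∀ u v, 0 ≤ f u v := fun u v => by
    simp only [f]; split_ifs
    · exact bump_nonneg _
    · exact le_rfl
  -- the support of `f u`
  have hsupp : ∀ u w, f u w ≠ 0 → u ∈ N ∧ dist u w ≤ δ w / 11 := by
    intro u w h
    simp only [f] at h
    split_ifs at h with hu
    · refine ⟨hu, ?_⟩
      have hdu := hδpos u (hNA hu)
      have h1 := norm_lt_one_of_bump_ne_zero h
      rw [norm_smul, Real.norm_eq_abs, abs_of_pos (by positivity), ← dist_eq_norm,
        div_mul_eq_mul_div, div_lt_one hdu, dist_comm] at h1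
      have := hδlip u w
      linarith
    · exact absurd rfl h
  have hsuppI : ∀ v ∉ A, ∀ w, dist w v ≤ δ v / 100 → ∀ u, f u w ≠ 0 → u ∈ I v := by
    intro v hv w hw u hu
    obtain ⟨huN, hud⟩ := hsupp u w hu
    rw [hI v hv]
    refine ⟨huN, ?_⟩
    have h1 := hδlip w v
    have h2 := dist_triangle u w v
    have := hδpos v hv
    linarith
  have hwA : ∀ v ∉ A, ∀ w, dist w v ≤ δ v / 100 → w ∉ A := by
    intro v hv w hw hwA
    have h1 : δ w = 0 := Metric.infDist_zero_of_mem hwA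
    have h2 := hδlip v w
    rw [dist_comm] at h2
    have := hδpos v hv
    linarith
  have hself : ∀ v ∉ A, dist v v ≤ δ v / 100 := fun v hv => by
    have := hδpos v hv; rw [dist_self]; positivity
  let Θ : F → ℝ := fun v => ∑ u ∈ I v, f u v
  have hΘ : ∀ v ∉ A, ∀ w, dist w v ≤ δ v / 100 → Θ w = ∑ u ∈ I v, f u w := by
    intro v hv w hw
    have hw' := hwA v hv w hw
    have h1 : ∑ u ∈ I w ∩ I v, f u w = ∑ u ∈ I w, f u w := by
      refine Finset.sum_subset Finset.inter_subset_left fun u hu hu' => ?_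
      by_contra hne
      exact hu' (Finset.mem_inter.2 ⟨hu, hsuppI v hv w hw u hne⟩)
    have h2 : ∑ u ∈ I w ∩ I v, f u w = ∑ u ∈ I v, f u w := by
      refine Finset.sum_subset Finset.inter_subset_right fun u hu hu' => ?_
      by_contra hne
      exact hu' (Finset.mem_inter.2 ⟨hsuppI w hw' w (hself w hw') u hne, hu⟩)
    exact h1.symm.trans h2
  have hΘlow : ∀ v ∉ A, 1 / 6 ≤ Θ v := by
    intro v hv
    obtain ⟨u, huN, hu⟩ := hNnet v hv
    have hdu := hδpos u (hNA huN)
    have h1 : 1 / 6 ≤ f u v := by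
      simp only [f, if_pos huN]
      apply bump_lower_bound
      rw [norm_smul, Real.norm_eq_abs, abs_of_pos (by positivity), ← dist_eq_norm]
      calc 12 / δ u * dist v u ≤ 12 / δ u * (δ u / 16) := by
            gcongr; exact hu.trans (min_le_right _ _)
        _ = 3 / 4 := by field_simp; norm_num
    have hmem : u ∈ I v := hsuppI v hv v (hself v hv) u (by linarith)
    exact h1.trans (Finset.single_le_sum (f := fun u => f u v) (fun i _ => hf0 i v) hmem)
  -- Taylor estimate for the active bumps
  have hlocal : ∀ v ∉ A, ∀ u ∈ I v, ‖l u v‖ ≤ 84 / δ v ∧ ∀ w, dist w v ≤ δ v / 100 →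
      |f u w - f u v - inner ℝ (l u v) (w - v)| ≤ 3600 * (dist w v / δ v) ^ 2 := by
    intro v hv u hu
    rw [hI v hv] at hu
    have hdv := hδpos v hv
    have hdu := hδpos u (hNA hu.1)
    have h1 := hδlip v u
    rw [dist_comm] at h1
    have h2 : 8 / 9 * δ v ≤ δ u := by linarith [hu.2]
    have h3 : 12 / δ u ≤ 14 / δ v := by
      rw [div_le_div_iff₀ hdu hdv]; linarith
    have hy : ‖(12 / δ u) • (v - u)‖ ≤ 3 / 2 := by
      rw [norm_smul, Real.norm_eq_abs, abs_of_pos (by positivity), ← dist_eq_norm, dist_comm,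
        div_mul_eq_mul_div, div_le_iff₀ hdu]
      linarith [hu.2]
    constructor
    · simp only [l]
      rw [norm_smul, Real.norm_eq_abs, abs_of_pos (by positivity)]
      calc 12 / δ u * ‖bumpGrad ((12 / δ u) • (v - u))‖ ≤ 14 / δ v * 6 := by
            gcongr; exact norm_bumpGrad_le hy
        _ = 84 / δ v := by ring
    · intro w hw
      have hh : ‖(12 / δ u) • (w - v)‖ ≤ 14 * (dist w v / δ v) := by
        rw [norm_smul, Real.norm_eq_abs, abs_of_pos (by positivity), ← dist_eq_norm]
        calc 12 / δ u * dist w v ≤ 14 / δ v * dist w v := by gcongr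
          _ = _ := by ring
      have ht : dist w v / δ v ≤ 1 / 100 := by
        rw [div_le_iff₀ hdv]; linarith
      have hB := abs_bump_sub_sub_le hy (hh.trans (by linarith))
      have e : (12 / δ u) • (v - u) + (12 / δ u) • (w - v) = (12 / δ u) • (w - u) := by
        rw [← smul_add]; congr 1; abel
      rw [e, real_inner_smul_right] at hB
      simp only [f, l, if_pos hu.1]
      rw [real_inner_smul_left]
      refine hB.trans ?_
      calc 18 * ‖(12 / δ u) • (w - v)‖ ^ 2 ≤ 18 * (14 * (dist w v / δ v)) ^ 2 := by gcongr
        _ = 3528 * (dist w v / δ v) ^ 2 := by ring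
        _ ≤ _ := by gcongr; norm_num
  have hcardI : ∀ v ∉ A, ((I v).card : ℝ) ≤ M := by
    intro v hv
    rw [hM]
    exact_mod_cast hcard v hv (I v) (fun u hu => (hI v hv u).1 hu)
  clear_value l
  refine ⟨{
    ψ := fun u v => f u v / Θ v
    m := fun u v => (1 / Θ v) • (l u v - (f u v / Θ v) • ∑ i ∈ I v, l i v)
    I := I
    near := a
    near_mem := haA
    dist_near := ?_
    nonneg := ?_
    eq_zero := ?_
    sum_eq_one := ?_
    taylor := ?_
    grad := ?_ }⟩
  · intro v hv u hu
    rw [hI v hv] at hu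
    have h1 := dist_triangle v u (a u)
    rw [← had u, dist_comm v u] at h1
    change _ ≤ _ + δ u at h1
    change _ ≤ 2 * δ v
    have h2 := hδlip u v
    have h3 := hδ0 v
    linarith [hu.2]
  · intro u v
    exact div_nonneg (hf0 u v) (Finset.sum_nonneg fun i _ => hf0 i v)
  · intro v hv w hw u hu
    have : f u w = 0 := by
      by_contra h
      exact hu (hsuppI v hv w hw u h)
    simp [this]
  · intro v hv w hw
    have h := hΘlow w (hwA v hv w hw)
    rw [← Finset.sum_div, ← hΘ v hv w hw]
    exact div_self (by linarith)
  · intro v hv w hw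
    have hdv := hδpos v hv
    have ht : dist w v / δ v ≤ 1 / 100 := by
      rw [div_le_iff₀ hdv]; linarith
    have hΘw := hΘlow w (hwA v hv w hw)
    have hΘv := hΘlow v hv
    have hq := quotient_taylor (I v) (fun u => f u w) (fun u => f u v)
      (fun u => inner ℝ (l u v) (w - v)) (K := 3600) (M := M) (t := dist w v / δ v) (by norm_num)
      hM1 (by positivity) (by linarith) (hcardI v hv) (fun i _ => hf0 i v)
      (fun i hi => (hlocal v hv i hi).2 w hw)
      (fun i hi => by
        refine (abs_real_inner_le_norm _ _).trans ?_
        rw [← dist_eq_norm]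
        calc ‖l i v‖ * dist w v ≤ 84 / δ v * dist w v := by
              gcongr; exact (hlocal v hv i hi).1
          _ = 84 * (dist w v / δ v) := by ring
          _ ≤ _ := by gcongr; norm_num)
      (by rw [← hΘ v hv w hw]; exact hΘw) (by rw [← hΘ v hv v (hself v hv)]; exact hΘv)
    rw [← hΘ v hv w hw, ← hΘ v hv v (hself v hv)] at hq
    calc _ ≤ ∑ u ∈ I v, 156 * M ^ 2 * 3600 ^ 2 * (dist w v / δ v) ^ 2 := by
          refine Finset.sum_le_sum fun u hu => ?_
          have e : inner ℝ ((1 / Θ v) • (l u v - (f u v / Θ v) • ∑ i ∈ I v, l i v)) (w - v) =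
              (inner ℝ (l u v) (w - v) -
                f u v / Θ v * ∑ i ∈ I v, inner ℝ (l i v) (w - v)) / Θ v := by
            rw [real_inner_smul_left, inner_sub_left, real_inner_smul_left, sum_inner]; ring
          rw [e]
          exact hq u hu
      _ = (I v).card * (156 * M ^ 2 * 3600 ^ 2 * (dist w v / δ v) ^ 2) := by
          rw [Finset.sum_const, nsmul_eq_mul]
      _ ≤ M * (156 * M ^ 2 * 3600 ^ 2 * (dist w v / δ v) ^ 2) := by
          gcongr; exact hcardI v hv
      _ = _ := by ring
  · intro v hv
    have hdv := hδpos v hv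
    have hΘv := hΘlow v hv
    have hΘ0 : 0 < Θ v := by linarith
    have hinv : 1 / Θ v ≤ 6 := by rw [div_le_iff₀ hΘ0]; linarith
    have hS : ‖∑ i ∈ I v, l i v‖ ≤ M * (84 / δ v) := by
      calc _ ≤ (I v).card • (84 / δ v) :=
            (norm_sum_le _ _).trans
              (Finset.sum_le_card_nsmul _ _ _ fun i hi => (hlocal v hv i hi).1)
        _ ≤ _ := by rw [nsmul_eq_mul]; gcongr; exact hcardI v hv
    have hψ1 : ∀ u ∈ I v, f u v / Θ v ≤ 1 := fun u hu =>
      (div_le_one hΘ0).2 (Finset.single_le_sum (f := fun u => f u v) (fun i _ => hf0 i v) hu)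
    calc _ ≤ ∑ u ∈ I v, 6 * (84 / δ v + 1 * (M * (84 / δ v))) := by
          refine Finset.sum_le_sum fun u hu => ?_
          rw [norm_smul, Real.norm_eq_abs, abs_of_pos (by positivity)]
          gcongr
          refine (norm_sub_le _ _).trans ?_
          rw [norm_smul, Real.norm_eq_abs, abs_of_nonneg (div_nonneg (hf0 u v) hΘ0.le)]
          gcongr
          · exact (hlocal v hv u hu).1
          · exact hψ1 u hu
      _ = (I v).card * (6 * (84 / δ v + 1 * (M * (84 / δ v)))) := by
          rw [Finset.sum_const, nsmul_eq_mul]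
      _ ≤ M * (6 * (84 / δ v + 1 * (M * (84 / δ v)))) := by gcongr; exact hcardI v hv
      _ = 504 * (M + M ^ 2) / δ v := by ring
      _ ≤ _ := by
          change _ ≤ _ / δ v
          have h2 : M ≤ M ^ 2 := by nlinarith
          have h3 : M ^ 2 ≤ M ^ 3 := by nlinarith [sq_nonneg M]
          exact div_le_div_of_nonneg_right (by nlinarith) hdv.le

end Whitney

/-! ### Extension of horizontal jets -/

section Jets

variable {F : Type*} [NormedAddCommGroup F]

theorem notMem_of_dist_le_infDist {A : Set F} (hA : IsClosed A) (hne : A.Nonempty) {v w : F}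
    (hv : v ∉ A) (hw : dist w v ≤ Metric.infDist v A / 100) : w ∉ A := by
  intro hwA
  have h1 : Metric.infDist v A ≤ dist v w := Metric.infDist_le_dist_of_mem hwA
  rw [dist_comm] at h1
  have := (hA.notMem_iff_infDist_pos hne).1 hv
  linarith

variable [InnerProductSpace ℝ F]
variable {Y : Type*} [NormedAddCommGroup Y] [NormedSpace ℝ Y]

/-- Sums against the partition of unity at `w` may be taken over the indices active near `v`. -/
theorem WhitneyPartition.sum_smul_congr {A : Set F} {K : ℝ} (W : WhitneyPartition A K)
    (hA : IsClosed A) (hne : A.Nonempty) {Z : Type*} [AddCommGroup Z] [Module ℝ Z] {v w : F}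
    (hv : v ∉ A) (hw : dist w v ≤ Metric.infDist v A / 100) (f : F → Z) :
    ∑ u ∈ W.I w, W.ψ u w • f u = ∑ u ∈ W.I v, W.ψ u w • f u := by
  classical
  have hwA := notMem_of_dist_le_infDist hA hne hv hw
  have hself : dist w w ≤ Metric.infDist w A / 100 := by
    have := Metric.infDist_nonneg (x := w) (s := A)
    rw [dist_self]; positivity
  have h1 : ∑ u ∈ W.I w ∩ W.I v, W.ψ u w • f u = ∑ u ∈ W.I w, W.ψ u w • f u := by
    refine Finset.sum_subset Finset.inter_subset_left fun u hu hu' => ?_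
    rw [W.eq_zero v hv w hw u fun h => hu' (Finset.mem_inter.2 ⟨hu, h⟩), zero_smul]
  have h2 : ∑ u ∈ W.I w ∩ W.I v, W.ψ u w • f u = ∑ u ∈ W.I v, W.ψ u w • f u := by
    refine Finset.sum_subset Finset.inter_subset_right fun u hu hu' => ?_
    rw [W.eq_zero w hwA w hself u fun h => hu' (Finset.mem_inter.2 ⟨h, hu⟩), zero_smul]
  exact h1.symm.trans h2

/-- Lipschitz bound for the partition of unity at the scale of the distance to `A`. -/
theorem WhitneyPartition.sum_abs_sub_le {A : Set F} {K : ℝ} (W : WhitneyPartition A K)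
    (hA : IsClosed A) (hne : A.Nonempty) (hK : 0 ≤ K) {v w : F}
    (hv : v ∉ A) (hw : dist w v ≤ Metric.infDist v A / 100) :
    ∑ u ∈ W.I v, |W.ψ u w - W.ψ u v| ≤ 2 * K * (‖w - v‖ / Metric.infDist v A) := by
  have hd := (hA.notMem_iff_infDist_pos hne).1 hv
  have h1 := W.taylor v hv w hw
  have h2 := W.grad v hv
  rw [dist_eq_norm] at h1 hw
  set d := Metric.infDist v A
  have ht : ‖w - v‖ / d ≤ 1 := by rw [div_le_one hd]; linarith
  have ht0 : 0 ≤ ‖w - v‖ / d := by positivity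
  calc _ ≤ ∑ u ∈ W.I v, (|W.ψ u w - W.ψ u v - inner ℝ (W.m u v) (w - v)| +
        ‖W.m u v‖ * ‖w - v‖) := by
        refine Finset.sum_le_sum fun u _ => ?_
        have h3 := abs_real_inner_le_norm (W.m u v) (w - v)
        have h4 := abs_add_le (W.ψ u w - W.ψ u v - inner ℝ (W.m u v) (w - v))
          (inner ℝ (W.m u v) (w - v))
        rw [sub_add_cancel] at h4
        linarith
    _ ≤ K * (‖w - v‖ / d) ^ 2 + K / d * ‖w - v‖ := by
        rw [Finset.sum_add_distrib, ← Finset.sum_mul]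
        gcongr
    _ = K * ((‖w - v‖ / d) ^ 2 + ‖w - v‖ / d) := by ring
    _ ≤ K * (‖w - v‖ / d + ‖w - v‖ / d) := by
        gcongr
        nlinarith
    _ = _ := by ring

/-- The error in the first order expansion of `s` at `w`, where the linear part `g w` is corrected
by the term `B (q w) (q v)`. -/
noncomputable def jetError (B : Y →ₗ[ℝ] Y →ₗ[ℝ] ℝ) (s : F → ℝ) (g : F → F) (q : F → Y)
    (v w : F) : ℝ :=
  s v - s w - inner ℝ (g w) (v - w) - B (q w) (q v)

/-- The triple `(s, g, q)` is a horizontal `1`-jet of size `ε` on `A`. If `B` is a symplectic form,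
this describes small intrinsic Lipschitz graphs over isotropic subspaces; for `q = 0` it is the
condition of Whitney's extension theorem for functions of class `C^{1,1}`. -/
structure IsHorizontalJet (B : Y →ₗ[ℝ] Y →ₗ[ℝ] ℝ) (ε : ℝ) (A : Set F) (s : F → ℝ) (g : F → F)
    (q : F → Y) : Prop where
  norm_g : ∀ v ∈ A, ∀ w ∈ A, ‖g v - g w‖ ≤ ε * ‖v - w‖
  norm_q : ∀ v ∈ A, ∀ w ∈ A, ‖q v - q w‖ ≤ ε * ‖v - w‖
  error : ∀ v ∈ A, ∀ w ∈ A, |jetError B s g q v w| ≤ ε * ‖v - w‖ ^ 2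

variable {B : Y →ₗ[ℝ] Y →ₗ[ℝ] ℝ}

/-- The change of base point in `jetError`. -/
theorem jetError_add (hB : ∀ x, B x x = 0) (s : F → ℝ) (g : F → F) (q : F → Y) (u v w : F) :
    jetError B s g q u v + jetError B s g q v w - jetError B s g q u w =
      inner ℝ (g w - g v) (u - v) + B (q w - q v) (q u - q v) := by
  have e : u - w = (u - v) + (v - w) := by abel
  unfold jetError
  rw [e, inner_add_right, inner_sub_left]
  simp only [map_sub, LinearMap.sub_apply, hB]
  ring

/-- On the whole space, the Lipschitz bound for the gradient follows from the other two conditions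
of a horizontal jet. -/
theorem norm_sub_le_of_jetError (hB : ∀ x, B x x = 0) (hBn : ∀ x y, |B x y| ≤ ‖x‖ * ‖y‖)
    {s : F → ℝ} {g : F → F} {q : F → Y} {C₁ C₂ : ℝ} (hC₁ : 0 ≤ C₁)
    (hq : ∀ v w, ‖q v - q w‖ ≤ C₁ * ‖v - w‖)
    (he : ∀ v w, |jetError B s g q v w| ≤ C₂ * ‖v - w‖ ^ 2) (v w : F) :
    ‖g v - g w‖ ≤ (6 * C₂ + C₁ ^ 2) * ‖v - w‖ := by
  by_cases hg : g w - g v = 0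
  · have hC₂ : 0 ≤ C₂ * ‖v - w‖ ^ 2 := (abs_nonneg _).trans (he v w)
    rw [norm_sub_rev, hg, norm_zero]
    rcases (norm_nonneg (v - w)).eq_or_lt with h | h
    · rw [← h]; simp
    · have : 0 ≤ C₂ := nonneg_of_mul_nonneg_left hC₂ (by positivity)
      positivity
  have hgp : 0 < ‖g w - g v‖ := norm_pos_iff.2 hg
  by_cases hvw : v = w
  · subst hvw; simp
  have hd : 0 < ‖v - w‖ := norm_pos_iff.2 (sub_ne_zero.2 hvw)
  -- test the change of base point in the direction of `g w - g v`, at distance `‖v - w‖`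
  set h : F := (‖v - w‖ / ‖g w - g v‖) • (g w - g v) with hh
  have hn : ‖h‖ = ‖v - w‖ := by
    rw [hh, norm_smul, Real.norm_eq_abs, abs_of_pos (by positivity)]; field_simp
  have hi : inner ℝ (g w - g v) h = ‖v - w‖ * ‖g w - g v‖ := by
    rw [hh, real_inner_smul_right, real_inner_self_eq_norm_sq]; field_simp
  have key := jetError_add hB s g q (v + h) v w
  rw [add_sub_cancel_left, hi] at key
  have e1 := he (v + h) v
  have e2 := he v w
  have e3 := he (v + h) w
  rw [add_sub_cancel_left, hn] at e1
  have hC₂ : 0 ≤ C₂ := nonneg_of_mul_nonneg_left ((abs_nonneg _).trans e2) (by positivity)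
  have e3' : |jetError B s g q (v + h) w| ≤ C₂ * (2 * ‖v - w‖) ^ 2 := by
    refine e3.trans ?_
    gcongr
    have : v + h - w = (v - w) + h := by abel
    rw [this]
    linarith [norm_add_le (v - w) h]
  have e4 : |B (q w - q v) (q (v + h) - q v)| ≤ C₁ * ‖v - w‖ * (C₁ * ‖v - w‖) := by
    refine (hBn _ _).trans ?_
    have h1 := hq w v
    have h2 := hq (v + h) v
    rw [add_sub_cancel_left, hn] at h2
    rw [norm_sub_rev w v] at h1
    gcongr
  rw [norm_sub_rev (g v)]
  refine le_of_mul_le_mul_left ?_ hd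
  rw [abs_le] at e1 e2 e3' e4
  nlinarith

/-- A horizontal jet of size `ε ≤ 1` on a closed set extends to a horizontal jet on the whole space
whose size is at most a dimensional multiple of `ε`. Here `s` and `q` are extended by Whitney's
formula. The terms `B (q (near u)) (q v)` that correct the Taylor polynomials of `s` add up to
`B (q v) (q v) = 0`. -/
theorem exists_horizontalJet_extension {A : Set F} (hA : IsClosed A) (hne : A.Nonempty)
    [FiniteDimensional ℝ F]
    (hB : ∀ x, B x x = 0) (hBn : ∀ x y, |B x y| ≤ ‖x‖ * ‖y‖) {K ε : ℝ} (hK : 1 ≤ K)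
    (W : WhitneyPartition A K) (hε : 0 ≤ ε) (hε1 : ε ≤ 1) {s : F → ℝ} {g : F → F} {q : F → Y}
    (hj : IsHorizontalJet B ε A s g q) :
    ∃ (s' : F → ℝ) (g' : F → F) (q' : F → Y), EqOn s' s A ∧ EqOn g' g A ∧ EqOn q' q A ∧
      IsHorizontalJet B (4000000 * K ^ 2 * ε) univ s' g' q' := by
  classical
  set δ : F → ℝ := fun v => Metric.infDist v A with hδdef
  have hδpos : ∀ v ∉ A, 0 < δ v := fun v hv => (hA.notMem_iff_infDist_pos hne).1 hv
  have hself : ∀ v ∉ A, dist v v ≤ δ v / 100 := fun v hv => by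
    have := hδpos v hv; rw [dist_self]; positivity
  choose a haA had using fun v : F => hA.exists_infDist_eq_dist hne v
  -- the contribution of the index `u` to the error at `v` relative to the base point `b`
  let σ : F → F → F → ℝ := fun b v u => s (W.near u) + inner ℝ (g (W.near u)) (v - W.near u) -
    s b - inner ℝ (g b) (v - b) - B (q b) (q (W.near u))
  have hnear : ∀ v ∉ A, ∀ b ∈ A, ∀ u ∈ W.I v,
      ‖W.near u - b‖ ≤ 3 * ‖v - b‖ ∧ ‖v - W.near u‖ ≤ 2 * ‖v - b‖ := by
    intro v hv b hb u hu
    have h1 := W.dist_near v hv u hu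
    have h2 : Metric.infDist v A ≤ dist v b := Metric.infDist_le_dist_of_mem hb
    rw [dist_eq_norm] at h1 h2
    have e : W.near u - b = (v - b) - (v - W.near u) := by abel
    constructor
    · rw [e]; refine (norm_sub_le _ _).trans ?_; linarith
    · linarith
  have hσ : ∀ v ∉ A, ∀ b ∈ A, ∀ u ∈ W.I v, |σ b v u| ≤ 15 * ε * ‖v - b‖ ^ 2 := by
    intro v hv b hb u hu
    obtain ⟨h1, h2⟩ := hnear v hv b hb u hu
    have e : σ b v u = inner ℝ (g (W.near u) - g b) (v - W.near u) +
        jetError B s g q (W.near u) b := by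
      simp only [σ, jetError]
      have : v - b = (v - W.near u) + (W.near u - b) := by abel
      rw [this, inner_add_right, inner_sub_left]; ring
    rw [e]
    calc _ ≤ |inner ℝ (g (W.near u) - g b) (v - W.near u)| +
          |jetError B s g q (W.near u) b| := abs_add_le _ _
      _ ≤ ε * (3 * ‖v - b‖) * (2 * ‖v - b‖) + ε * (3 * ‖v - b‖) ^ 2 := by
          gcongr
          · refine (abs_real_inner_le_norm _ _).trans ?_
            gcongr
            exact (hj.norm_g _ (W.near_mem u) _ hb).trans (by gcongr)
          · exact (hj.error _ (W.near_mem u) _ hb).trans (by gcongr)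
      _ = _ := by ring
  let s' : F → ℝ := fun v => if v ∈ A then s v else
    ∑ u ∈ W.I v, W.ψ u v * (s (W.near u) + inner ℝ (g (W.near u)) (v - W.near u))
  let q' : F → Y := fun v => if v ∈ A then q v else ∑ u ∈ W.I v, W.ψ u v • q (W.near u)
  -- the gradient of `s'`, corrected so that the expansion at `v` contains `B (q' v) (q' w)`
  let g' : F → F := fun v => if v ∈ A then g v else
    g (a v) + ∑ u ∈ W.I v, W.ψ u v • (g (W.near u) - g (a v)) +
      ∑ u ∈ W.I v, (σ (a v) v u - B (q' v - q (a v)) (q (W.near u) - q (a v))) • W.m u v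
  have hs'A : ∀ v ∈ A, s' v = s v := fun v hv => if_pos hv
  have hq'A : ∀ v ∈ A, q' v = q v := fun v hv => if_pos hv
  have hg'A : ∀ v ∈ A, g' v = g v := fun v hv => if_pos hv
  have hext : ∀ v ∉ A, ∀ w, dist w v ≤ δ v / 100 → w ∉ A := fun v hv w hw =>
    notMem_of_dist_le_infDist hA hne hv hw
  have hq'rep : ∀ v ∉ A, ∀ w, dist w v ≤ δ v / 100 → ∀ b,
      q' w = q b + ∑ u ∈ W.I v, W.ψ u w • (q (W.near u) - q b) := by
    intro v hv w hw b
    simp only [q', if_neg (hext v hv w hw)]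
    rw [W.sum_smul_congr hA hne hv hw]
    simp only [smul_sub, Finset.sum_sub_distrib]
    rw [← Finset.sum_smul, W.sum_eq_one v hv w hw, one_smul]
    abel
  have hs'rep : ∀ v ∉ A, ∀ w, dist w v ≤ δ v / 100 → ∀ b,
      s' w = s b + inner ℝ (g b) (w - b) + B (q b) (q' w) + ∑ u ∈ W.I v, W.ψ u w *
        (σ b v u + inner ℝ (g (W.near u) - g b) (w - v)) := by
    intro v hv w hw b
    have h1 : B (q b) (q' w) = ∑ u ∈ W.I v, W.ψ u w * B (q b) (q (W.near u)) := by
      rw [hq'rep v hv w hw b, map_add, hB, zero_add, map_sum]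
      refine Finset.sum_congr rfl fun u _ => ?_
      rw [map_smul, map_sub, hB, sub_zero, smul_eq_mul]
    have h2 : s b + inner ℝ (g b) (w - b) =
        ∑ u ∈ W.I v, W.ψ u w * (s b + inner ℝ (g b) (w - b)) := by
      rw [← Finset.sum_mul, W.sum_eq_one v hv w hw, one_mul]
    have h3 : s' w = ∑ u ∈ W.I v, W.ψ u w *
        (s (W.near u) + inner ℝ (g (W.near u)) (w - W.near u)) := by
      simp only [s', if_neg (hext v hv w hw)]
      exact W.sum_smul_congr hA hne hv hw fun u =>
        s (W.near u) + inner ℝ (g (W.near u)) (w - W.near u)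
    rw [h1, h2, h3, ← Finset.sum_add_distrib, ← Finset.sum_add_distrib]
    refine Finset.sum_congr rfl fun u _ => ?_
    have e1 : w - W.near u = (w - v) + (v - W.near u) := by abel
    have e2 : w - b = (w - v) + (v - b) := by abel
    simp only [σ]
    rw [e1, e2, inner_add_right, inner_add_right, inner_sub_left]
    ring
  -- sums against the partition of unity are averages
  have havg : ∀ v ∉ A, ∀ (f : F → ℝ) (c : ℝ), (∀ u ∈ W.I v, f u ≤ c) →
      ∑ u ∈ W.I v, W.ψ u v * f u ≤ c := by
    intro v hv f c hf
    calc _ ≤ ∑ u ∈ W.I v, W.ψ u v * c := by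
          refine Finset.sum_le_sum fun u hu => ?_
          exact mul_le_mul_of_nonneg_left (hf u hu) (W.nonneg u v)
      _ = c := by rw [← Finset.sum_mul, W.sum_eq_one v hv v (hself v hv), one_mul]
  have hqb : ∀ v ∉ A, ∀ b ∈ A, ‖q' v - q b‖ ≤ 3 * ε * ‖v - b‖ := by
    intro v hv b hb
    rw [hq'rep v hv v (hself v hv) b, add_sub_cancel_left]
    calc _ ≤ ∑ u ∈ W.I v, W.ψ u v * ‖q (W.near u) - q b‖ := by
          refine (norm_sum_le _ _).trans (Finset.sum_le_sum fun u _ => ?_)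
          rw [norm_smul, Real.norm_eq_abs, abs_of_nonneg (W.nonneg u v)]
      _ ≤ _ := havg v hv _ _ fun u hu => by
          refine (hj.norm_q _ (W.near_mem u) _ hb).trans ?_
          have := (hnear v hv b hb u hu).1
          calc ε * ‖W.near u - b‖ ≤ ε * (3 * ‖v - b‖) := by gcongr
            _ = _ := by ring
  have heb : ∀ v ∉ A, ∀ b ∈ A, |jetError B s' g' q' v b| ≤ 15 * ε * ‖v - b‖ ^ 2 := by
    intro v hv b hb
    have e : jetError B s' g' q' v b = ∑ u ∈ W.I v, W.ψ u v * σ b v u := by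
      unfold jetError
      rw [hs'rep v hv v (hself v hv) b, hs'A b hb, hq'A b hb, hg'A b hb]
      simp only [sub_self, inner_zero_right, add_zero]
      ring
    rw [e]
    calc _ ≤ ∑ u ∈ W.I v, W.ψ u v * |σ b v u| := by
          refine (Finset.abs_sum_le_sum_abs _ _).trans (Finset.sum_le_sum fun u _ => ?_)
          rw [abs_mul, abs_of_nonneg (W.nonneg u v)]
      _ ≤ _ := havg v hv _ _ fun u hu => hσ v hv b hb u hu
  -- the same two bounds for arbitrary points
  have hqb' : ∀ v, ∀ b ∈ A, ‖q' v - q' b‖ ≤ 3 * ε * ‖v - b‖ := by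
    intro v b hb
    rw [hq'A b hb]
    by_cases hv : v ∈ A
    · rw [hq'A v hv]
      refine (hj.norm_q v hv b hb).trans ?_
      gcongr; linarith
    · exact hqb v hv b hb
  have heb' : ∀ v, ∀ b ∈ A, |jetError B s' g' q' v b| ≤ 15 * ε * ‖v - b‖ ^ 2 := by
    intro v b hb
    by_cases hv : v ∈ A
    · have : jetError B s' g' q' v b = jetError B s g q v b := by
        unfold jetError; rw [hs'A v hv, hs'A b hb, hq'A b hb, hg'A b hb, hq'A v hv]
      rw [this]
      refine (hj.error v hv b hb).trans ?_
      gcongr; linarith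
    · exact heb v hv b hb
  have haδ : ∀ v, ‖v - a v‖ = δ v := fun v => by rw [← dist_eq_norm, ← had v]
  have hcoef : ∀ v ∉ A, ∀ u ∈ W.I v,
      |σ (a v) v u - B (q' v - q (a v)) (q (W.near u) - q (a v))| ≤ 24 * ε * δ v ^ 2 := by
    intro v hv u hu
    have h1 := hσ v hv (a v) (haA v) u hu
    have h2 := hqb v hv (a v) (haA v)
    have h3 : ‖q (W.near u) - q (a v)‖ ≤ 3 * ε * δ v := by
      refine (hj.norm_q _ (W.near_mem u) _ (haA v)).trans ?_
      have := (hnear v hv (a v) (haA v) u hu).1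
      rw [haδ] at this
      calc ε * ‖W.near u - a v‖ ≤ ε * (3 * δ v) := by gcongr
        _ = _ := by ring
    rw [haδ] at h1 h2
    calc _ ≤ |σ (a v) v u| + |B (q' v - q (a v)) (q (W.near u) - q (a v))| := abs_sub _ _
      _ ≤ 15 * ε * δ v ^ 2 + (3 * 1 * δ v) * (3 * ε * δ v) := by
          gcongr
          refine (hBn _ _).trans ?_
          have hd := (hδpos v hv).le
          gcongr
          refine h2.trans ?_
          gcongr
      _ = _ := by ring
  have hga : ∀ v ∉ A, ‖g (a v) - g' v‖ ≤ 27 * K * ε * δ v := by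
    intro v hv
    have hd := hδpos v hv
    rw [norm_sub_rev]
    simp only [g', if_neg hv]
    rw [add_assoc, add_sub_cancel_left]
    have h1 : ‖∑ u ∈ W.I v, W.ψ u v • (g (W.near u) - g (a v))‖ ≤ 3 * ε * δ v := by
      calc _ ≤ ∑ u ∈ W.I v, W.ψ u v * ‖g (W.near u) - g (a v)‖ := by
            refine (norm_sum_le _ _).trans (Finset.sum_le_sum fun u _ => ?_)
            rw [norm_smul, Real.norm_eq_abs, abs_of_nonneg (W.nonneg u v)]
        _ ≤ _ := havg v hv _ _ fun u hu => by
            refine (hj.norm_g _ (W.near_mem u) _ (haA v)).trans ?_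
            have := (hnear v hv (a v) (haA v) u hu).1
            rw [haδ] at this
            calc ε * ‖W.near u - a v‖ ≤ ε * (3 * δ v) := by gcongr
              _ = _ := by ring
    have h2 : ‖∑ u ∈ W.I v, (σ (a v) v u - B (q' v - q (a v)) (q (W.near u) - q (a v))) •
        W.m u v‖ ≤ 24 * ε * δ v ^ 2 * (K / δ v) := by
      calc _ ≤ ∑ u ∈ W.I v, 24 * ε * δ v ^ 2 * ‖W.m u v‖ := by
            refine (norm_sum_le _ _).trans (Finset.sum_le_sum fun u hu => ?_)
            rw [norm_smul, Real.norm_eq_abs]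
            gcongr
            exact hcoef v hv u hu
        _ ≤ _ := by
            rw [← Finset.mul_sum]
            gcongr
            exact W.grad v hv
    have h3 : 24 * ε * δ v ^ 2 * (K / δ v) = 24 * K * ε * δ v := by field_simp
    have h4 : 3 * ε * δ v ≤ 3 * K * ε * δ v := by
      have : 0 ≤ ε * δ v := by positivity
      nlinarith
    refine (norm_add_le _ _).trans ?_
    linarith
  have hlip : ∀ v ∉ A, ∀ w, dist w v ≤ δ v / 100 →
      ∑ u ∈ W.I v, |W.ψ u w - W.ψ u v| ≤ 2 * K * (‖w - v‖ / δ v) := fun v hv w hw =>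
    W.sum_abs_sub_le hA hne (by linarith) hv hw
  have hKε : ε ≤ K * ε := le_mul_of_one_le_left hε hK
  have hqlip : ∀ w v, ‖q' w - q' v‖ ≤ 603 * K * ε * ‖w - v‖ := by
    intro w v
    by_cases hv : v ∈ A
    · refine (hqb' w v hv).trans ?_
      have : 0 ≤ ‖w - v‖ := norm_nonneg _
      gcongr ?_ * _
      linarith
    have hd := hδpos v hv
    by_cases hw : dist w v ≤ δ v / 100
    · rw [hq'rep v hv w hw (a v), hq'rep v hv v (hself v hv) (a v), add_sub_add_left_eq_sub,
        ← Finset.sum_sub_distrib]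
      calc _ ≤ ∑ u ∈ W.I v, |W.ψ u w - W.ψ u v| * (3 * ε * δ v) := by
            refine (norm_sum_le _ _).trans (Finset.sum_le_sum fun u hu => ?_)
            rw [← sub_smul, norm_smul, Real.norm_eq_abs]
            gcongr
            refine (hj.norm_q _ (W.near_mem u) _ (haA v)).trans ?_
            have := (hnear v hv (a v) (haA v) u hu).1
            rw [haδ] at this
            calc ε * ‖W.near u - a v‖ ≤ ε * (3 * δ v) := by gcongr
              _ = _ := by ring
        _ ≤ 2 * K * (‖w - v‖ / δ v) * (3 * ε * δ v) := by
            rw [← Finset.sum_mul]; gcongr; exact hlip v hv w hw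
        _ = 6 * K * ε * ‖w - v‖ := by field_simp; ring
        _ ≤ _ := by gcongr; norm_num
    · rw [not_le, dist_eq_norm] at hw
      have h1 := hqb' w (a v) (haA v)
      have h2 := hqb' v (a v) (haA v)
      have h3 : ‖w - a v‖ ≤ 101 * ‖w - v‖ := by
        have : w - a v = (w - v) + (v - a v) := by abel
        rw [this]
        refine (norm_add_le _ _).trans ?_
        rw [haδ]; linarith
      rw [haδ] at h2
      have e : q' w - q' v = (q' w - q' (a v)) - (q' v - q' (a v)) := by abel
      rw [e]
      calc _ ≤ _ := norm_sub_le _ _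
        _ ≤ 3 * ε * (101 * ‖w - v‖) + 3 * ε * (100 * ‖w - v‖) := by
            gcongr
            · exact h1.trans (by gcongr)
            · exact h2.trans (by gcongr; linarith)
        _ = 603 * ε * ‖w - v‖ := by ring
        _ ≤ _ := by gcongr ?_ * _; linarith
  have herr : ∀ w v, |jetError B s' g' q' w v| ≤ 500000 * K * ε * ‖w - v‖ ^ 2 := by
    intro w v
    by_cases hv : v ∈ A
    · refine (heb' w v hv).trans ?_
      gcongr ?_ * _
      linarith
    have hd := hδpos v hv
    by_cases hw : dist w v ≤ δ v / 100
    · have hq1 : q' w - q' v = ∑ u ∈ W.I v, (W.ψ u w - W.ψ u v) • (q (W.near u) - q (a v)) := by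
        rw [hq'rep v hv w hw (a v), hq'rep v hv v (hself v hv) (a v), add_sub_add_left_eq_sub,
          ← Finset.sum_sub_distrib]
        simp only [sub_smul]
      have hBq : B (q' v) (q' w) = B (q (a v)) (q' w) - B (q (a v)) (q' v) +
          B (q' v - q (a v)) (q' w - q' v) := by
        have := hB (q' v)
        simp only [map_sub, LinearMap.sub_apply]
        linarith
      have hgi : inner ℝ (g' v) (w - v) = inner ℝ (g (a v)) (w - v) +
          ∑ u ∈ W.I v, W.ψ u v * inner ℝ (g (W.near u) - g (a v)) (w - v) +
          ∑ u ∈ W.I v, (σ (a v) v u - B (q' v - q (a v)) (q (W.near u) - q (a v))) *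
            inner ℝ (W.m u v) (w - v) := by
        simp only [g', if_neg hv]
        rw [inner_add_left, inner_add_left, sum_inner, sum_inner]
        simp only [real_inner_smul_left]
      have e : jetError B s' g' q' w v =
          ∑ u ∈ W.I v, ((W.ψ u w - W.ψ u v - inner ℝ (W.m u v) (w - v)) *
            (σ (a v) v u - B (q' v - q (a v)) (q (W.near u) - q (a v))) +
            (W.ψ u w - W.ψ u v) * inner ℝ (g (W.near u) - g (a v)) (w - v)) := by
        unfold jetError
        rw [hBq, hgi, hs'rep v hv w hw (a v), hs'rep v hv v (hself v hv) (a v)]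
        have hB2 : B (q' v - q (a v)) (q' w - q' v) = ∑ u ∈ W.I v, (W.ψ u w - W.ψ u v) *
            B (q' v - q (a v)) (q (W.near u) - q (a v)) := by
          rw [hq1, map_sum]
          exact Finset.sum_congr rfl fun u _ => by rw [map_smul, smul_eq_mul]
        rw [hB2]
        have e2 : w - a v = (w - v) + (v - a v) := by abel
        rw [e2, inner_add_right]
        simp only [sub_self, inner_zero_right, add_zero, mul_add, sub_mul, mul_sub,
          Finset.sum_add_distrib, Finset.sum_sub_distrib, mul_comm (inner ℝ (W.m _ v) (w - v))]
        ring
      have hγ : ∀ u ∈ W.I v, |inner ℝ (g (W.near u) - g (a v)) (w - v)| ≤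
          3 * ε * δ v * ‖w - v‖ := by
        intro u hu
        refine (abs_real_inner_le_norm _ _).trans ?_
        gcongr
        refine (hj.norm_g _ (W.near_mem u) _ (haA v)).trans ?_
        have := (hnear v hv (a v) (haA v) u hu).1
        rw [haδ] at this
        calc ε * ‖W.near u - a v‖ ≤ ε * (3 * δ v) := by gcongr
          _ = _ := by ring
      rw [e]
      calc _ ≤ ∑ u ∈ W.I v, (|W.ψ u w - W.ψ u v - inner ℝ (W.m u v) (w - v)| *
              (24 * ε * δ v ^ 2) + |W.ψ u w - W.ψ u v| * (3 * ε * δ v * ‖w - v‖)) := by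
            refine (Finset.abs_sum_le_sum_abs _ _).trans (Finset.sum_le_sum fun u hu => ?_)
            refine (abs_add_le _ _).trans ?_
            rw [abs_mul, abs_mul]
            gcongr
            · exact hcoef v hv u hu
            · exact hγ u hu
        _ ≤ K * (‖w - v‖ / δ v) ^ 2 * (24 * ε * δ v ^ 2) +
              2 * K * (‖w - v‖ / δ v) * (3 * ε * δ v * ‖w - v‖) := by
            rw [Finset.sum_add_distrib, ← Finset.sum_mul, ← Finset.sum_mul]
            have h1 := W.taylor v hv w hw
            rw [dist_eq_norm] at h1
            gcongr
            exact hlip v hv w hw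
        _ = 30 * K * ε * ‖w - v‖ ^ 2 := by field_simp; ring
        _ ≤ _ := by gcongr; norm_num
    · rw [not_le, dist_eq_norm] at hw
      -- compare the expansions at `v` and at the point `a v` of `A`
      have key := jetError_add hB s' g' q' w v (a v)
      have h1 := heb' w (a v) (haA v)
      have h2 := heb' v (a v) (haA v)
      have h3 : ‖w - a v‖ ≤ 101 * ‖w - v‖ := by
        have : w - a v = (w - v) + (v - a v) := by abel
        rw [this]
        refine (norm_add_le _ _).trans ?_
        rw [haδ]; linarith
      have h4 := hga v hv
      rw [← hg'A (a v) (haA v)] at h4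
      have h5 := hqb' v (a v) (haA v)
      have h6 := hqlip w v
      rw [haδ] at h2 h5
      rw [norm_sub_rev] at h5
      have hδ' : δ v ≤ 100 * ‖w - v‖ := by linarith
      have e : jetError B s' g' q' w v = jetError B s' g' q' w (a v) -
          jetError B s' g' q' v (a v) + inner ℝ (g' (a v) - g' v) (w - v) +
          B (q' (a v) - q' v) (q' w - q' v) := by linarith
      rw [e]
      calc _ ≤ |jetError B s' g' q' w (a v)| + |jetError B s' g' q' v (a v)| +
            |inner ℝ (g' (a v) - g' v) (w - v)| + |B (q' (a v) - q' v) (q' w - q' v)| := by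
            refine (abs_add_le _ _).trans ?_
            gcongr
            refine (abs_add_le _ _).trans ?_
            gcongr
            exact abs_sub _ _
        _ ≤ 15 * ε * (101 * ‖w - v‖) ^ 2 + 15 * ε * (100 * ‖w - v‖) ^ 2 +
            27 * K * ε * (100 * ‖w - v‖) * ‖w - v‖ +
            (3 * 1 * (100 * ‖w - v‖)) * (603 * K * ε * ‖w - v‖) := by
            gcongr
            · exact h1.trans (by gcongr)
            · exact h2.trans (by gcongr)
            · refine (abs_real_inner_le_norm _ _).trans ?_
              gcongr
              exact h4.trans (by gcongr)
            · refine (hBn _ _).trans ?_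
              gcongr
              exact h5.trans (by gcongr)
        _ = (303015 * ε + 183600 * (K * ε)) * ‖w - v‖ ^ 2 := by ring
        _ ≤ _ := by gcongr; linarith
  refine ⟨s', g', q', hs'A, hg'A, hq'A, ?_, ?_, ?_⟩
  · intro v _ w _
    refine (norm_sub_le_of_jetError hB hBn (by positivity) hqlip herr v w).trans ?_
    gcongr ?_ * _
    have h1 : ε ^ 2 ≤ ε := by nlinarith
    have h2 : K * ε ≤ K ^ 2 * ε := by gcongr; nlinarith
    have h3 : (603 * K * ε) ^ 2 ≤ 363609 * (K ^ 2 * ε) := by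
      calc (603 * K * ε) ^ 2 = 363609 * (K ^ 2 * ε ^ 2) := by ring
        _ ≤ _ := by gcongr
    linarith
  · intro v _ w _
    refine (hqlip v w).trans ?_
    gcongr ?_ * _
    have h2 : K * ε ≤ K ^ 2 * ε := by gcongr; nlinarith
    have : 0 ≤ K ^ 2 * ε := by positivity
    linarith
  · intro v _ w _
    refine (herr v w).trans ?_
    gcongr ?_ * _
    have h2 : K * ε ≤ K ^ 2 * ε := by gcongr; nlinarith
    have : 0 ≤ K ^ 2 * ε := by positivity
    linarith

end Jets

namespace Heis

variable {n : ℕ}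

/-! ### The complex structure and isotropic subspaces -/

/-- The rotation `J` of `ℝ²ⁿ` with `ω(z, w) = ½ ⟨z, J w⟩`. -/
noncomputable def rot :
    EuclideanSpace ℝ (Fin n ⊕ Fin n) →ₗ[ℝ] EuclideanSpace ℝ (Fin n ⊕ Fin n) where
  toFun w := WithLp.toLp 2 (Sum.elim (fun i => w (Sum.inr i)) (fun i => -w (Sum.inl i)))
  map_add' w w' := by ext i; rcases i with i | i <;> simp [add_comm]
  map_smul' c w := by ext i; rcases i with i | i <;> simp

@[simp] theorem rot_inl (w : EuclideanSpace ℝ (Fin n ⊕ Fin n)) (i : Fin n) :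
    rot w (Sum.inl i) = w (Sum.inr i) := rfl

@[simp] theorem rot_inr (w : EuclideanSpace ℝ (Fin n ⊕ Fin n)) (i : Fin n) :
    rot w (Sum.inr i) = -w (Sum.inl i) := rfl

theorem rot_rot (w : EuclideanSpace ℝ (Fin n ⊕ Fin n)) : rot (rot w) = -w := by
  ext i; rcases i with i | i <;> simp

theorem omega_eq_inner (z w : EuclideanSpace ℝ (Fin n ⊕ Fin n)) :
    omega z w = 1 / 2 * inner ℝ z (rot w) := by
  rw [PiLp.inner_apply, Fintype.sum_sum_type, ← Finset.sum_add_distrib, omega]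
  congr 1
  exact Finset.sum_congr rfl fun i _ => by simp; ring

theorem inner_rot_left (z w : EuclideanSpace ℝ (Fin n ⊕ Fin n)) :
    inner ℝ (rot z) w = -inner ℝ z (rot w) := by
  rw [PiLp.inner_apply, PiLp.inner_apply, Fintype.sum_sum_type, Fintype.sum_sum_type,
    ← Finset.sum_add_distrib, ← Finset.sum_add_distrib, ← Finset.sum_neg_distrib]
  exact Finset.sum_congr rfl fun i _ => by simp

theorem norm_rot (w : EuclideanSpace ℝ (Fin n ⊕ Fin n)) : ‖rot w‖ = ‖w‖ := by
  rw [norm_eq_sqrt_real_inner, norm_eq_sqrt_real_inner (F := EuclideanSpace ℝ _) w, inner_rot_left,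
    rot_rot, inner_neg_right, neg_neg]

theorem abs_omega_le (z w : EuclideanSpace ℝ (Fin n ⊕ Fin n)) : |omega z w| ≤ ‖z‖ * ‖w‖ := by
  have h := abs_real_inner_le_norm z (rot w)
  rw [norm_rot] at h
  rw [omega_eq_inner, abs_mul, abs_of_pos (by norm_num)]
  have := norm_nonneg z
  have := norm_nonneg w
  nlinarith [abs_nonneg (inner ℝ z (rot w) : ℝ)]

theorem omega_swap (z w : EuclideanSpace ℝ (Fin n ⊕ Fin n)) : omega z w = -omega w z := by
  have h := omega_self (z + w)
  rw [omega_add_left, omega_add_right, omega_add_right, omega_self, omega_self] at h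
  linarith

theorem omega_neg_right (z w : EuclideanSpace ℝ (Fin n ⊕ Fin n)) : omega z (-w) = -omega z w := by
  rw [omega_swap, omega_neg_left, omega_swap w, neg_neg]

theorem omega_sub_left (z z' w : EuclideanSpace ℝ (Fin n ⊕ Fin n)) :
    omega (z - z') w = omega z w - omega z' w := by
  rw [sub_eq_add_neg, omega_add_left, omega_neg_left, sub_eq_add_neg]

theorem omega_sub_right (z w w' : EuclideanSpace ℝ (Fin n ⊕ Fin n)) :
    omega z (w - w') = omega z w - omega z w' := by
  rw [sub_eq_add_neg, omega_add_right, omega_neg_right, sub_eq_add_neg]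

/-- The form `ω` as a bilinear map. -/
noncomputable def omegaForm : EuclideanSpace ℝ (Fin n ⊕ Fin n) →ₗ[ℝ]
    EuclideanSpace ℝ (Fin n ⊕ Fin n) →ₗ[ℝ] ℝ :=
  LinearMap.mk₂ ℝ omega omega_add_left
    (fun c z w => by
      rw [omega_eq_inner, omega_eq_inner, real_inner_smul_left, smul_eq_mul]; ring)
    omega_add_right
    (fun c z w => by
      rw [omega_eq_inner, omega_eq_inner, map_smul, real_inner_smul_right, smul_eq_mul]; ring)

@[simp] theorem omegaForm_apply (z w : EuclideanSpace ℝ (Fin n ⊕ Fin n)) :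
    omegaForm z w = omega z w := rfl

variable {V : Submodule ℝ (EuclideanSpace ℝ (Fin n ⊕ Fin n))}

theorem IsIsotropic.inner_rot {k : ℕ} (hV : IsIsotropic k V)
    {v w : EuclideanSpace ℝ (Fin n ⊕ Fin n)} (hv : v ∈ V) (hw : w ∈ V) :
    inner ℝ v (rot w) = 0 := by
  have h := hV.2 v hv w hw
  rw [omega_eq_inner] at h
  linarith

/-- The orthogonal complement of `V ⊕ J V`. -/
noncomputable def symplecticComplement
    (V : Submodule ℝ (EuclideanSpace ℝ (Fin n ⊕ Fin n))) :
    Submodule ℝ (EuclideanSpace ℝ (Fin n ⊕ Fin n)) :=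
  Vᗮ ⊓ (V.map rot)ᗮ

theorem inner_of_mem_symplecticComplement {v q : EuclideanSpace ℝ (Fin n ⊕ Fin n)} (hv : v ∈ V)
    (hq : q ∈ symplecticComplement V) : inner ℝ v q = 0 ∧ inner ℝ v (rot q) = 0 := by
  refine ⟨(Submodule.mem_orthogonal _ _).1 hq.1 v hv, ?_⟩
  have h := (Submodule.mem_orthogonal _ _).1 hq.2 (rot v) (Submodule.mem_map_of_mem hv)
  rw [inner_rot_left] at h
  linarith

/-- On `J V ⊕ U`, where `U` is the orthogonal complement of `V ⊕ J V`, the form `ω` only depends on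
the component in `U`. -/
theorem omega_add_rot {k : ℕ} (hV : IsIsotropic k V)
    {g g' q q' : EuclideanSpace ℝ (Fin n ⊕ Fin n)} (hg : g ∈ V) (hg' : g' ∈ V)
    (hq : q ∈ symplecticComplement V) (hq' : q' ∈ symplecticComplement V) :
    omega (q' + rot g') (q + rot g) = omega q' q := by
  have h1 : omega q' (rot g) = 0 := by
    rw [omega_eq_inner, rot_rot, inner_neg_right, real_inner_comm,
      (inner_of_mem_symplecticComplement hg hq').1]; simp
  have h2 : omega q (rot g') = 0 := by
    rw [omega_eq_inner, rot_rot, inner_neg_right, real_inner_comm,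
      (inner_of_mem_symplecticComplement hg' hq).1]; simp
  have h3 : omega (rot g') (rot g) = 0 := by
    rw [omega_eq_inner, rot_rot, inner_neg_right, real_inner_comm, hV.inner_rot hg hg']; simp
  rw [omega_add_left, omega_add_right, omega_add_right, h1, h3, omega_swap (rot g'), h2]
  ring

theorem omega_rot_of_mem {v g q : EuclideanSpace ℝ (Fin n ⊕ Fin n)} (hv : v ∈ V)
    (hq : q ∈ symplecticComplement V) : omega v (q + rot g) = -(1 / 2) * inner ℝ g v := by
  rw [omega_eq_inner, map_add, rot_rot, inner_add_right, inner_neg_right,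
    (inner_of_mem_symplecticComplement hv hq).2, real_inner_comm]
  ring

theorem add_rot_mem_orthogonal {k : ℕ} (hV : IsIsotropic k V)
    {g q : EuclideanSpace ℝ (Fin n ⊕ Fin n)} (hg : g ∈ V) (hq : q ∈ symplecticComplement V) :
    q + rot g ∈ Vᗮ :=
  Submodule.add_mem _ hq.1 ((Submodule.mem_orthogonal _ _).2 fun _ hv => hV.inner_rot hv hg)

/-- The component of a vector of `Vᗮ` in the orthogonal complement of `V ⊕ J V`. -/
theorem add_rot_starProjection_mem {k : ℕ} (hV : IsIsotropic k V)
    {w : EuclideanSpace ℝ (Fin n ⊕ Fin n)} (hw : w ∈ Vᗮ) :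
    w + rot (V.starProjection (rot w)) ∈ symplecticComplement V := by
  refine ⟨Submodule.add_mem _ hw ((Submodule.mem_orthogonal _ _).2 fun v hv =>
    hV.inner_rot hv (V.starProjection_apply_mem _)), ?_⟩
  refine (Submodule.mem_orthogonal _ _).2 fun u hu => ?_
  obtain ⟨v, hv, rfl⟩ := hu
  have h1 := Submodule.starProjection_inner_eq_zero (K := V) (rot w) v hv
  rw [inner_sub_left] at h1
  rw [inner_add_right, inner_rot_left, inner_rot_left, rot_rot, inner_neg_right,
    real_inner_comm (rot w), real_inner_comm (V.starProjection (rot w))]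
  linarith

/-! ### The distance between points of a graph -/

theorem inv_mul_z (x y : Heis n) : (y⁻¹ * x).z = x.z - y.z := by
  simp [sub_eq_neg_add]

theorem inv_mul_t (x y : Heis n) : (y⁻¹ * x).t = x.t - y.t - omega y.z x.z := by
  simp [omega_neg_left]; ring

theorem koranyi_horizontal (z : EuclideanSpace ℝ (Fin n ⊕ Fin n)) :
    koranyi (⟨z, 0⟩ : Heis n) = ‖z‖ := by
  refine (pow_left_inj₀ (koranyi_nonneg _) (norm_nonneg _) (n := 4) (by norm_num)).1 ?_
  rw [koranyi_pow]; simp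

theorem koranyi_projH (p : Heis n) : koranyi (projH V p) = ‖V.starProjection p.z‖ :=
  koranyi_horizontal _

theorem projW_z (p : Heis n) : (projW V p).z = p.z - V.starProjection p.z := by
  simp [projW, projH, sub_eq_neg_add]

theorem projW_t (p : Heis n) : (projW V p).t = p.t - omega (V.starProjection p.z) p.z := by
  simp [projW, projH, omega_neg_left, sub_eq_add_neg]

theorem koranyi_le_projH_add_projW (p : Heis n) :
    koranyi p ≤ koranyi (projH V p) + koranyi (projW V p) := by
  have h := koranyi_mul_le (projH V p) (projW V p)
  rwa [projW, mul_inv_cancel_left] at h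

/-- The points of an affine horizontal plane have the Euclidean distance of their projections to
the direction space. -/
theorem dist_projAffine {k : ℕ} (hV : IsIsotropic k V) (p x y : Heis n) :
    dist (projAffine p V x) (projAffine p V y) = ‖V.starProjection (x.z - y.z)‖ := by
  have e : (projAffine p V y)⁻¹ * projAffine p V x =
      ⟨V.starProjection (x.z - y.z), 0⟩ := by
    have h1 : (projAffine p V y)⁻¹ * projAffine p V x =
        (projH V (p⁻¹ * y))⁻¹ * projH V (p⁻¹ * x) := by
      unfold projAffine; group
    rw [h1]
    ext1
    · simp only [projH, inv_mul_z, map_sub]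
      abel
    · rw [inv_mul_t]
      simp only [projH]
      rw [hV.2 _ (V.starProjection_apply_mem _) _ (V.starProjection_apply_mem _)]
      simp
  rw [dist_def, e, koranyi_horizontal]

/-- The point of the graph over `v` with parameters `w ∈ Vᗮ` and `s`. -/
noncomputable def graphPoint (v w : EuclideanSpace ℝ (Fin n ⊕ Fin n)) (s : ℝ) : Heis n :=
  ⟨v + w, s + omega v w⟩

/-- In the coordinates `w = q + J g`, the vertical component of the projection to `Vᗮ × ℝ` of a
difference of graph points is the error in a first order expansion of `s` with gradient `g`. -/
theorem graphPoint_vertical {k : ℕ} (hV : IsIsotropic k V)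
    {v v' g g' q q' : EuclideanSpace ℝ (Fin n ⊕ Fin n)} (hv : v ∈ V) (hv' : v' ∈ V) (hg : g ∈ V)
    (hg' : g' ∈ V) (hq : q ∈ symplecticComplement V) (hq' : q' ∈ symplecticComplement V)
    (s s' : ℝ) :
    ((graphPoint v' (q' + rot g') s')⁻¹ * graphPoint v (q + rot g) s).t -
      omega (v - v') (q + rot g - (q' + rot g')) =
      s - s' - inner ℝ g' (v - v') - omega q' q := by
  have h1 := omega_add_rot hV hg hg' hq hq'
  have h2 := omega_rot_of_mem (g := g') (V.sub_mem hv hv') hq'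
  have h3 := hV.2 v' hv' v hv
  rw [← h1]
  set w := q + rot g
  set w' := q' + rot g'
  rw [inv_mul_t]
  simp only [graphPoint]
  rw [omega_sub_left] at h2
  simp only [omega_add_left, omega_add_right, omega_sub_left, omega_sub_right, h3]
  rw [omega_swap w' v]
  linarith

/-! ### Extension of intrinsic Lipschitz graphs -/

theorem norm_z_sub_le_dist (x y : Heis n) : ‖x.z - y.z‖ ≤ dist x y := by
  rw [dist_def, ← inv_mul_z]; exact norm_z_le _

theorem dist_pow_four (x y : Heis n) :
    dist x y ^ 4 = ‖x.z - y.z‖ ^ 4 + 16 * (x.t - y.t - omega y.z x.z) ^ 2 := by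
  rw [dist_def, koranyi_pow, inv_mul_z, inv_mul_t]

instance : CompleteSpace (Heis n) := by
  refine Metric.complete_of_cauchySeq_tendsto fun u hu => ?_
  have hz : CauchySeq fun m => (u m).z := by
    rw [Metric.cauchySeq_iff] at hu ⊢
    intro ε hε
    obtain ⟨N, hN⟩ := hu ε hε
    refine ⟨N, fun a ha b hb => ?_⟩
    rw [dist_eq_norm]
    exact (norm_z_sub_le_dist _ _).trans_lt (hN a ha b hb)
  obtain ⟨R, hR0, hR⟩ := cauchySeq_bdd hu
  obtain ⟨z, hzlim⟩ := cauchySeq_tendsto_of_complete hz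
  have hbz : ∃ C, 0 ≤ C ∧ ∀ m, ‖(u m).z‖ ≤ C := by
    obtain ⟨C, hC⟩ := hz.norm_bddAbove
    exact ⟨C, (norm_nonneg _).trans (hC ⟨0, rfl⟩), fun m => hC ⟨m, rfl⟩⟩
  obtain ⟨C, hC0, hC⟩ := hbz
  -- the vertical coordinates are controlled by the distance and the horizontal coordinates
  have ht_le : ∀ a b, |(u a).t - (u b).t| ≤ (R + C) * dist (u a) (u b) := by
    intro a b
    have h1 : |(u a).t - (u b).t - omega (u b).z (u a).z| ≤ dist (u a) (u b) ^ 2 := by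
      refine abs_le_of_sq_le_sq ?_ (by positivity)
      have := dist_pow_four (u a) (u b)
      have h0 : 0 ≤ ‖(u a).z - (u b).z‖ ^ 4 := by positivity
      nlinarith [sq_nonneg ((u a).t - (u b).t - omega (u b).z (u a).z)]
    have h2 : |omega (u b).z (u a).z| ≤ C * dist (u a) (u b) := by
      have e : omega (u b).z (u a).z = omega (u b).z ((u a).z - (u b).z) := by
        rw [omega_sub_right, omega_self, sub_zero]
      rw [e]
      refine (abs_omega_le _ _).trans ?_
      gcongr
      · exact hC b
      · exact norm_z_sub_le_dist _ _
    have h3 : dist (u a) (u b) ^ 2 ≤ R * dist (u a) (u b) := by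
      rw [sq]; gcongr; exact (hR a b).le
    have h4 := abs_add_le ((u a).t - (u b).t - omega (u b).z (u a).z) (omega (u b).z (u a).z)
    rw [sub_add_cancel] at h4
    linarith
  have ht : CauchySeq fun m => (u m).t := by
    rw [Metric.cauchySeq_iff] at hu ⊢
    intro ε hε
    obtain ⟨N, hN⟩ := hu (ε / (R + C + 1)) (by positivity)
    refine ⟨N, fun a ha b hb => ?_⟩
    rw [Real.dist_eq]
    have h := hN a ha b hb
    rw [lt_div_iff₀ (by positivity)] at h
    have := ht_le a b
    have := dist_nonneg (x := u a) (y := u b)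
    nlinarith
  obtain ⟨t, htlim⟩ := cauchySeq_tendsto_of_complete ht
  refine ⟨⟨z, t⟩, ?_⟩
  rw [tendsto_iff_dist_tendsto_zero]
  have h4 : Filter.Tendsto (fun m => dist (u m) (⟨z, t⟩ : Heis n) ^ 4) Filter.atTop (nhds 0) := by
    simp only [dist_pow_four]
    have hzsub : Filter.Tendsto (fun m => (u m).z - z) Filter.atTop (nhds 0) := by
      simpa using hzlim.sub_const z
    have h1 : Filter.Tendsto (fun m => ‖(u m).z - z‖ ^ 4) Filter.atTop (nhds 0) := by
      simpa using hzsub.norm.pow 4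
    have h2 : Filter.Tendsto (fun m => omega z (u m).z) Filter.atTop (nhds 0) := by
      refine squeeze_zero_norm (a := fun m => ‖z‖ * ‖(u m).z - z‖) (fun m => ?_) ?_
      · have e : omega z (u m).z = omega z ((u m).z - z) := by
          rw [omega_sub_right, omega_self, sub_zero]
        rw [e]; exact abs_omega_le _ _
      · simpa using hzsub.norm.const_mul ‖z‖
    have h3 : Filter.Tendsto (fun m => (u m).t - t - omega z (u m).z) Filter.atTop (nhds 0) := by
      simpa using (htlim.sub_const t).sub h2
    simpa using h1.add ((h3.pow 2).const_mul 16)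
  have h5 := h4.rpow_const (p := 1 / 4) (Or.inr (by norm_num))
  rw [Real.zero_rpow (by norm_num)] at h5
  refine h5.congr fun m => ?_
  rw [← Real.rpow_natCast, ← Real.rpow_mul dist_nonneg]
  norm_num

theorem continuous_z : Continuous (fun x : Heis n => x.z) := by
  refine (LipschitzWith.of_dist_le_mul (K := 1) fun x y => ?_).continuous
  rw [dist_eq_norm, NNReal.coe_one, one_mul]
  exact norm_z_sub_le_dist x y

theorem dist_le_of_mem_closure {C : ℝ} {G : Set (Heis n)}
    (hd : ∀ x ∈ G, ∀ y ∈ G, dist x y ≤ C * ‖V.starProjection (x.z - y.z)‖) :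
    ∀ x ∈ closure G, ∀ y ∈ closure G, dist x y ≤ C * ‖V.starProjection (x.z - y.z)‖ := by
  have hcont : Continuous fun p : Heis n × Heis n => C * ‖V.starProjection (p.1.z - p.2.z)‖ :=
    continuous_const.mul (V.starProjection.continuous.comp
      ((continuous_z.comp continuous_fst).sub (continuous_z.comp continuous_snd))).norm
  intro x hx y hy
  have hxy : (x, y) ∈ closure (G ×ˢ G) := by
    rw [closure_prod_eq]; exact mk_mem_prod hx hy
  have h := le_on_closure (s := G ×ˢ G) (f := fun p : Heis n × Heis n => dist p.1 p.2)
    (g := fun p : Heis n × Heis n => C * ‖V.starProjection (p.1.z - p.2.z)‖)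
    (fun p hp => hd p.1 hp.1 p.2 hp.2) continuous_dist.continuousOn hcont.continuousOn hxy
  exact h

/-- Points whose distance is almost that of their projections to `V` differ by a small element
relative to the splitting into `V` and its complement. -/
theorem small_components_of_dist_le {η : ℝ} (hη : 0 ≤ η) (hη1 : η ≤ 1) {x y : Heis n}
    (h : dist x y ≤ (1 + 2 * η) * ‖V.starProjection (x.z - y.z)‖) {ε : ℝ} (hε : 0 ≤ ε)
    (hηε : 32 * η ≤ ε ^ 2) :
    2 * ‖x.z - y.z - V.starProjection (x.z - y.z)‖ ≤ ε * ‖V.starProjection (x.z - y.z)‖ ∧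
      2 * |(y⁻¹ * x).t| ≤ ε * ‖V.starProjection (x.z - y.z)‖ ^ 2 := by
  have hz := norm_z_sub_le_dist x y
  have hp := Submodule.norm_sq_eq_add_norm_sq_starProjection (x.z - y.z) V
  rw [Submodule.starProjection_orthogonal_val] at hp
  have h4 := dist_pow_four x y
  rw [← inv_mul_t] at h4
  set a := ‖V.starProjection (x.z - y.z)‖
  set b := ‖x.z - y.z - V.starProjection (x.z - y.z)‖
  set c := ‖x.z - y.z‖
  have ha : 0 ≤ a := norm_nonneg _
  have hb : 0 ≤ b := norm_nonneg _
  have hc : 0 ≤ c := norm_nonneg _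
  have hca : c ≤ (1 + 2 * η) * a := hz.trans h
  have e1 : (1 + 2 * η) ^ 2 - 1 ≤ 8 * η := by nlinarith
  have e2 : (1 + 2 * η) ^ 4 - 1 ≤ 80 * η := by
    have h1 : (1 + 2 * η) ^ 2 ≤ 9 := by nlinarith
    have : (1 + 2 * η) ^ 4 - 1 = ((1 + 2 * η) ^ 2 - 1) * ((1 + 2 * η) ^ 2 + 1) := by ring
    rw [this]
    have h0 : 0 ≤ (1 + 2 * η) ^ 2 - 1 := by nlinarith
    nlinarith
  constructor
  · refine le_of_pow_le_pow_left₀ (n := 2) (by norm_num) (by positivity) ?_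
    have h1 : c ^ 2 ≤ ((1 + 2 * η) * a) ^ 2 := by gcongr
    have h2 : ((1 + 2 * η) ^ 2 - 1) * a ^ 2 ≤ 8 * η * a ^ 2 := by gcongr
    have h3 : 32 * η * a ^ 2 ≤ ε ^ 2 * a ^ 2 := by gcongr
    nlinarith
  · refine le_of_pow_le_pow_left₀ (n := 2) (by norm_num) (by positivity) ?_
    have h1 : dist x y ^ 4 ≤ ((1 + 2 * η) * a) ^ 4 := by gcongr
    have h2 : ((1 + 2 * η) ^ 4 - 1) * a ^ 4 ≤ 80 * η * a ^ 4 := by gcongr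
    have h3 : 32 * η * a ^ 4 ≤ ε ^ 2 * a ^ 4 := by gcongr
    have h5 : a ^ 4 ≤ c ^ 4 := by
      gcongr
      exact V.norm_starProjection_apply_le _
    rw [mul_pow, sq_abs]
    nlinarith

/-- A horizontal jet of size `ε` on `V` defines an intrinsic Lipschitz graph whose constant is of
order `√ε`. -/
theorem isIntrinsicLipschitzGraph_of_jet {k : ℕ} (hV : IsIsotropic k V) {ε L : ℝ} (hL : 0 ≤ L)
    (hε1 : ε ≤ 1) (hεL : 32 * ε ^ 2 ≤ L ^ 4) {s : V → ℝ} {g : V → V}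
    {q : V → symplecticComplement V}
    (hj : IsHorizontalJet (omegaForm.domRestrict₁₂ (symplecticComplement V)
      (symplecticComplement V)) ε univ s g q) (hε : 0 ≤ ε) :
    IsIntrinsicLipschitzGraph k L
      (range fun v : V => graphPoint (v : EuclideanSpace ℝ (Fin n ⊕ Fin n))
        ((q v : EuclideanSpace ℝ (Fin n ⊕ Fin n)) + rot (g v : EuclideanSpace ℝ (Fin n ⊕ Fin n)))
        (s v)) := by
  refine ⟨V, hV, fun p => ⟨⟨(q ⟨p.1.z, p.2.1⟩ : EuclideanSpace ℝ (Fin n ⊕ Fin n)) +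
    rot (g ⟨p.1.z, p.2.1⟩ : EuclideanSpace ℝ (Fin n ⊕ Fin n)), s ⟨p.1.z, p.2.1⟩⟩,
    add_rot_mem_orthogonal hV (g _).2 (q _).2⟩, ?_, ?_⟩
  · intro p p'
    obtain ⟨⟨v, t⟩, hv, ht⟩ := p
    obtain ⟨⟨v', t'⟩, hv', ht'⟩ := p'
    simp only at hv ht hv' ht'
    subst ht ht'
    have e : ∀ (v w : EuclideanSpace ℝ (Fin n ⊕ Fin n)) (s : ℝ),
        (⟨v, 0⟩ : Heis n) * ⟨w, s⟩ = graphPoint v w s := by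
      intro v w s
      ext1
      · rfl
      · simp [graphPoint]
    simp only [graphMap, e]
    have hvert := graphPoint_vertical hV hv hv' (g ⟨v, hv⟩).2 (g ⟨v', hv'⟩).2 (q ⟨v, hv⟩).2
      (q ⟨v', hv'⟩).2 (s ⟨v, hv⟩) (s ⟨v', hv'⟩)
    have hw := add_rot_mem_orthogonal hV (g ⟨v, hv⟩).2 (q ⟨v, hv⟩).2
    have hw' := add_rot_mem_orthogonal hV (g ⟨v', hv'⟩).2 (q ⟨v', hv'⟩).2
    have hg := hj.norm_g ⟨v, hv⟩ trivial ⟨v', hv'⟩ trivial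
    have hq := hj.norm_q ⟨v, hv⟩ trivial ⟨v', hv'⟩ trivial
    have he := hj.error ⟨v, hv⟩ trivial ⟨v', hv'⟩ trivial
    have he' : |s ⟨v, hv⟩ - s ⟨v', hv'⟩ -
        inner ℝ ((g ⟨v', hv'⟩ : V) : EuclideanSpace ℝ (Fin n ⊕ Fin n)) (v - v') -
        omega (q ⟨v', hv'⟩ : EuclideanSpace ℝ (Fin n ⊕ Fin n)) (q ⟨v, hv⟩)| ≤
          ε * ‖v - v'‖ ^ 2 := he
    rw [← hvert] at he'
    have hwd : ‖((q ⟨v, hv⟩ : EuclideanSpace ℝ (Fin n ⊕ Fin n)) +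
          rot (g ⟨v, hv⟩ : EuclideanSpace ℝ (Fin n ⊕ Fin n))) -
        ((q ⟨v', hv'⟩ : EuclideanSpace ℝ (Fin n ⊕ Fin n)) +
          rot (g ⟨v', hv'⟩ : EuclideanSpace ℝ (Fin n ⊕ Fin n)))‖ ≤ 2 * ε * ‖v - v'‖ := by
      have e1 : ((q ⟨v, hv⟩ : EuclideanSpace ℝ (Fin n ⊕ Fin n)) +
          rot (g ⟨v, hv⟩ : EuclideanSpace ℝ (Fin n ⊕ Fin n))) -
        ((q ⟨v', hv'⟩ : EuclideanSpace ℝ (Fin n ⊕ Fin n)) +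
          rot (g ⟨v', hv'⟩ : EuclideanSpace ℝ (Fin n ⊕ Fin n))) = ((q ⟨v, hv⟩ - q ⟨v', hv'⟩ :
          symplecticComplement V) : EuclideanSpace ℝ (Fin n ⊕ Fin n)) +
          rot ((g ⟨v, hv⟩ - g ⟨v', hv'⟩ : V) : EuclideanSpace ℝ (Fin n ⊕ Fin n)) := by
        push_cast
        rw [map_sub]; abel
      rw [e1]
      refine (norm_add_le _ _).trans ?_
      rw [norm_rot]
      have h1 : ‖((q ⟨v, hv⟩ - q ⟨v', hv'⟩ :
          symplecticComplement V) : EuclideanSpace ℝ (Fin n ⊕ Fin n))‖ ≤ ε * ‖v - v'‖ := hq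
      have h2 : ‖((g ⟨v, hv⟩ - g ⟨v', hv'⟩ : V) : EuclideanSpace ℝ (Fin n ⊕ Fin n))‖ ≤
          ε * ‖v - v'‖ := hg
      linarith
    set w := (q ⟨v, hv⟩ : EuclideanSpace ℝ (Fin n ⊕ Fin n)) +
          rot (g ⟨v, hv⟩ : EuclideanSpace ℝ (Fin n ⊕ Fin n))
    set w' := (q ⟨v', hv'⟩ : EuclideanSpace ℝ (Fin n ⊕ Fin n)) +
          rot (g ⟨v', hv'⟩ : EuclideanSpace ℝ (Fin n ⊕ Fin n))
    have hz : ((graphPoint v' w' (s ⟨v', hv'⟩))⁻¹ * graphPoint v w (s ⟨v, hv⟩)).z =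
        (v - v') + (w - w') := by
      rw [inv_mul_z]; simp only [graphPoint]; abel
    have hπ : V.starProjection ((v - v') + (w - w')) = v - v' := by
      rw [map_add, Submodule.starProjection_eq_self_iff.2 (V.sub_mem hv hv'),
        (Submodule.starProjection_apply_eq_zero_iff V).2 (Submodule.sub_mem _ hw hw'), add_zero]
    rw [koranyi_projH, hz, hπ]
    refine le_of_pow_le_pow_left₀ (n := 4) (by norm_num) (by positivity) ?_
    rw [koranyi_pow, projW_z, projW_t, hz, hπ, add_sub_cancel_left, omega_add_right, omega_self,
      zero_add]
    have h1 : ‖w - w'‖ ^ 4 ≤ (2 * ε * ‖v - v'‖) ^ 4 := by gcongr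
    have h2 := pow_le_pow_left₀ (abs_nonneg _) he' 2
    rw [sq_abs] at h2
    have h3 : ε ^ 4 ≤ ε ^ 2 := pow_le_pow_of_le_one hε hε1 (by norm_num)
    calc _ ≤ (2 * ε * ‖v - v'‖) ^ 4 + 16 * (ε * ‖v - v'‖ ^ 2) ^ 2 := by gcongr
      _ = (16 * ε ^ 4 + 16 * ε ^ 2) * ‖v - v'‖ ^ 4 := by ring
      _ ≤ L ^ 4 * ‖v - v'‖ ^ 4 := by gcongr; linarith
      _ = _ := by ring
  · ext x
    constructor
    · rintro ⟨v, rfl⟩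
      refine ⟨⟨⟨v, 0⟩, v.2, rfl⟩, ?_⟩
      ext1
      · rfl
      · simp [graphMap, graphPoint]
    · rintro ⟨⟨⟨v, t⟩, hv, ht⟩, rfl⟩
      simp only at hv ht
      subst ht
      refine ⟨⟨v, hv⟩, ?_⟩
      ext1
      · rfl
      · simp [graphMap, graphPoint]

/-- A set on which the projection to a horizontal subgroup almost preserves distances is contained
in an intrinsic Lipschitz graph with small constant. -/
theorem exists_intrinsicLipschitzGraph_superset (k : ℕ) {L : ℝ} (hL : 0 < L) :
    ∃ η : ℝ, 0 < η ∧ ∀ (n : ℕ) (V : Submodule ℝ (EuclideanSpace ℝ (Fin n ⊕ Fin n))),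
      IsIsotropic k V → ∀ G : Set (Heis n), G.Nonempty →
        (∀ x ∈ G, ∀ y ∈ G, dist x y ≤ (1 + 2 * η) * ‖V.starProjection (x.z - y.z)‖) →
        ∃ Γ, IsIntrinsicLipschitzGraph k L Γ ∧ G ⊆ Γ := by
  set M : ℝ := 5 ^ k with hM
  have hM1 : 1 ≤ M := one_le_pow₀ (by norm_num)
  set K : ℝ := 156 * M ^ 3 * 3600 ^ 2 with hKdef
  have hK : 1 ≤ K := by
    have : 1 ≤ M ^ 3 := one_le_pow₀ hM1
    rw [hKdef]; nlinarith
  -- a jet of size `ε₁` has a graph with constant `L`, a jet of size `ε` extends to one of size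
  -- `ε₁`, and the hypothesis with `η = ε ^ 2 / 32` gives a jet of size `ε`
  set ε₁ : ℝ := min 1 (L ^ 2 / 6) with hε₁
  have hε₁0 : 0 < ε₁ := lt_min one_pos (by positivity)
  have hε₁1 : ε₁ ≤ 1 := min_le_left _ _
  have hε₁L : 32 * ε₁ ^ 2 ≤ L ^ 4 := by
    have h : ε₁ ^ 2 ≤ (L ^ 2 / 6) ^ 2 := by gcongr; exact min_le_right _ _
    have : 0 ≤ L ^ 4 := by positivity
    nlinarith
  set ε : ℝ := ε₁ / (4000000 * K ^ 2) with hεdef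
  have hε0 : 0 < ε := by positivity
  have hεε₁ : 4000000 * K ^ 2 * ε = ε₁ := by rw [hεdef]; field_simp
  have hε1 : ε ≤ 1 := by
    have : 1 ≤ K ^ 2 := one_le_pow₀ hK
    rw [hεdef, div_le_one (by positivity)]
    linarith
  have hη1 : ε ^ 2 / 32 ≤ 1 := by nlinarith
  refine ⟨ε ^ 2 / 32, by positivity, fun n V hV G hG hd => ?_⟩
  have hηε : 32 * (ε ^ 2 / 32) ≤ ε ^ 2 := by linarith
  have hη0 : 0 ≤ ε ^ 2 / 32 := by positivity
  generalize ε ^ 2 / 32 = η at *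
  have hd' := dist_le_of_mem_closure hd
  let A : Set V := {v | ∃ x ∈ closure G, V.starProjection x.z = v}
  have hAne : A.Nonempty := by
    obtain ⟨x, hx⟩ := hG
    exact ⟨⟨_, V.starProjection_apply_mem x.z⟩, x, subset_closure hx, rfl⟩
  have hlift : ∀ v : V, ∃ x : Heis n, v ∈ A → x ∈ closure G ∧ V.starProjection x.z = v := by
    intro v
    by_cases hv : v ∈ A
    · obtain ⟨x, hx, hxv⟩ := hv
      exact ⟨x, fun _ => ⟨hx, hxv⟩⟩
    · exact ⟨1, fun h => absurd h hv⟩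
  choose X hX using hlift
  have hXd : ∀ v ∈ A, ∀ w ∈ A, dist (X v) (X w) ≤ (1 + 2 * η) * ‖v - w‖ := by
    intro v hv w hw
    have h := hd' _ (hX v hv).1 _ (hX w hw).1
    rw [map_sub, (hX v hv).2, (hX w hw).2] at h
    exact h
  have hXeq : ∀ x ∈ closure G, ∀ v : V, V.starProjection x.z = v → X v = x := by
    intro x hx v hv
    have hvA : v ∈ A := ⟨x, hx, hv⟩
    have h := hd' _ (hX v hvA).1 _ hx
    rw [map_sub, (hX v hvA).2, hv, sub_self, norm_zero, mul_zero] at h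
    exact dist_le_zero.1 h
  -- the projection of the closure is closed since it is complete
  have hA : IsClosed A := by
    refine IsSeqClosed.isClosed fun a v ha hav => ?_
    have hc : CauchySeq fun m => X (a m) := by
      have h := hav.cauchySeq
      rw [Metric.cauchySeq_iff] at h ⊢
      intro r hr
      obtain ⟨N, hN⟩ := h (r / (1 + 2 * η)) (by positivity)
      refine ⟨N, fun i hi j hj => (hXd _ (ha i) _ (ha j)).trans_lt ?_⟩
      have := hN i hi j hj
      rw [lt_div_iff₀ (by positivity), dist_eq_norm] at this
      linarith
    obtain ⟨x, hx⟩ := cauchySeq_tendsto_of_complete hc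
    refine ⟨x, isClosed_closure.mem_of_tendsto hx
      (Filter.Eventually.of_forall fun m => (hX _ (ha m)).1), ?_⟩
    have h1 : Filter.Tendsto (fun m => V.starProjection (X (a m)).z) Filter.atTop
        (nhds (V.starProjection x.z)) :=
      ((V.starProjection.continuous.comp continuous_z).tendsto x).comp hx
    have h2 : Filter.Tendsto (fun m => ((a m : V) : EuclideanSpace ℝ (Fin n ⊕ Fin n)))
        Filter.atTop (nhds v) := (continuous_subtype_val.tendsto v).comp hav
    refine tendsto_nhds_unique (h1.congr fun m => (hX _ (ha m)).2) h2
  -- the jet of the graph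
  let w : V → EuclideanSpace ℝ (Fin n ⊕ Fin n) := fun v => (X v).z - V.starProjection (X v).z
  have hw : ∀ v, w v ∈ Vᗮ := fun v => Submodule.sub_starProjection_mem_orthogonal _
  let g : V → V := fun v => -⟨V.starProjection (rot (w v)), V.starProjection_apply_mem _⟩
  let q : V → symplecticComplement V := fun v =>
    ⟨w v + rot (V.starProjection (rot (w v))), add_rot_starProjection_mem hV (hw v)⟩
  let s : V → ℝ := fun v => (X v).t - omega v (w v)
  have hqg : ∀ v, (q v : EuclideanSpace ℝ (Fin n ⊕ Fin n)) + rot (g v) = w v := by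
    intro v
    simp only [q, g, Submodule.coe_neg, map_neg]
    abel
  have hXpt : ∀ v ∈ A, graphPoint (v : EuclideanSpace ℝ (Fin n ⊕ Fin n))
      ((q v : EuclideanSpace ℝ (Fin n ⊕ Fin n)) + rot (g v : EuclideanSpace ℝ (Fin n ⊕ Fin n)))
      (s v) = X v := by
    intro v hv
    rw [hqg]
    ext1
    · simp only [graphPoint, w, (hX v hv).2]; abel
    · simp [graphPoint, s]
  have hj : IsHorizontalJet (omegaForm.domRestrict₁₂ (symplecticComplement V)
      (symplecticComplement V)) ε A s g q := by
    have hwle : ∀ v ∈ A, ∀ v' ∈ A, 2 * ‖w v - w v'‖ ≤ ε * ‖v - v'‖ ∧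
        2 * |((X v')⁻¹ * X v).t| ≤ ε * ‖v - v'‖ ^ 2 := by
      intro v hv v' hv'
      have h := small_components_of_dist_le hη0 hη1 (hd' _ (hX v hv).1 _ (hX v' hv').1) hε0.le hηε
      have e : (X v).z - (X v').z - V.starProjection ((X v).z - (X v').z) = w v - w v' := by
        simp only [w, map_sub]; abel
      rw [e, map_sub, (hX v hv).2, (hX v' hv').2] at h
      exact h
    have hge : ∀ v v', ‖g v - g v'‖ ≤ ‖w v - w v'‖ := by
      intro v v'
      have e : ((g v - g v' : V) : EuclideanSpace ℝ (Fin n ⊕ Fin n)) =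
          -V.starProjection (rot (w v - w v')) := by
        simp only [g, map_sub]; push_cast; abel
      rw [Submodule.coe_norm, e, norm_neg]
      refine (V.norm_starProjection_apply_le _).trans ?_
      rw [norm_rot]
    refine ⟨fun v hv v' hv' => ?_, fun v hv v' hv' => ?_, fun v hv v' hv' => ?_⟩
    · have := (hwle v hv v' hv').1
      have := hge v v'
      have := norm_nonneg (w v - w v')
      linarith
    · have e : ((q v - q v' : symplecticComplement V) : EuclideanSpace ℝ (Fin n ⊕ Fin n)) =
          (w v - w v') - rot ((g v - g v' : V) : EuclideanSpace ℝ (Fin n ⊕ Fin n)) := by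
        rw [← hqg, ← hqg]; push_cast; rw [map_sub]; abel
      rw [Submodule.coe_norm, e]
      refine (norm_sub_le _ _).trans ?_
      rw [norm_rot, ← Submodule.coe_norm]
      have := (hwle v hv v' hv').1
      have := hge v v'
      linarith
    · have hvert := graphPoint_vertical hV v.2 v'.2 (g v).2 (g v').2 (q v).2 (q v').2 (s v) (s v')
      rw [hXpt v hv, hXpt v' hv', hqg, hqg] at hvert
      have e : jetError (omegaForm.domRestrict₁₂ (symplecticComplement V)
          (symplecticComplement V)) s g q v v' = ((X v')⁻¹ * X v).t -
            omega (v - v' : EuclideanSpace ℝ (Fin n ⊕ Fin n)) (w v - w v') := hvert.symm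
      rw [e]
      obtain ⟨h1, h2⟩ := hwle v hv v' hv'
      have h3 := abs_omega_le (v - v' : EuclideanSpace ℝ (Fin n ⊕ Fin n)) (w v - w v')
      have h4 : ‖(v - v' : EuclideanSpace ℝ (Fin n ⊕ Fin n))‖ = ‖v - v'‖ := rfl
      rw [h4] at h3
      have h5 := mul_le_mul_of_nonneg_left h1 (norm_nonneg (v - v'))
      refine (abs_sub _ _).trans ?_
      nlinarith
  obtain ⟨W⟩ := exists_whitneyPartition hA hAne (M := M) (by rw [hM, hV.1])
  obtain ⟨s', g', q', hs', hg', hq', hj'⟩ := exists_horizontalJet_extension hA hAne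
    (fun x => omega_self _) (fun x y => abs_omega_le _ _) hK W hε0.le hε1 hj
  rw [hεε₁] at hj'
  refine ⟨_, isIntrinsicLipschitzGraph_of_jet hV hL.le hε₁1 hε₁L hj' hε₁0.le, fun x hx => ?_⟩
  have hxc := subset_closure hx
  have hvA : (⟨V.starProjection x.z, V.starProjection_apply_mem _⟩ : V) ∈ A := ⟨x, hxc, rfl⟩
  refine ⟨⟨V.starProjection x.z, V.starProjection_apply_mem _⟩, ?_⟩
  change graphPoint _ _ _ = _
  rw [hs' hvA, hg' hvA, hq' hvA, hXpt _ hvA]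
  exact hXeq x hxc _ rfl

variable {k : ℕ} {E : Set (Heis n)} {𝒟 : DyadicSystem k E}

/-! ### Dyadic cubes -/

theorem DyadicSystem.subset_of_mem_cubes {Q : Set (Heis n)} (hQ : Q ∈ 𝒟.cubes) : Q ⊆ E := by
  obtain ⟨j, hj, hQ⟩ := hQ
  rw [← 𝒟.cover j hj]
  exact subset_sUnion_of_mem hQ

theorem DyadicSystem.nonempty_of_mem_cubes {Q : Set (Heis n)} (hQ : Q ∈ 𝒟.cubes) : Q.Nonempty := by
  obtain ⟨j, hj, hQ⟩ := hQ
  rw [nonempty_iff_ne_empty]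
  rintro rfl
  have h := 𝒟.le_measure j hj ∅ hQ
  rw [measure_empty, nonpos_iff_eq_zero, ENNReal.ofReal_eq_zero] at h
  have h1 := 𝒟.one_lt_D
  have h2 := zpow_pos 𝒟.ρ_pos j
  have : 0 < 𝒟.D⁻¹ * (𝒟.ρ ^ j) ^ k := by positivity
  linarith

theorem DyadicSystem.isBounded_of_mem_cubes {Q : Set (Heis n)} (hQ : Q ∈ 𝒟.cubes) :
    Bornology.IsBounded Q := by
  obtain ⟨j, hj, hQ⟩ := hQ
  rw [Metric.isBounded_iff_ediam_ne_top]
  exact ((𝒟.diam_le j hj Q hQ).trans_lt ENNReal.ofReal_lt_top).ne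

theorem DyadicSystem.real_diam_le {j : ℤ} (hj : j ∈ 𝒟.J) {Q : Set (Heis n)} (hQ : Q ∈ 𝒟.gen j) :
    Metric.diam Q ≤ 𝒟.D * 𝒟.ρ ^ j := by
  have h1 := 𝒟.one_lt_D
  have h2 := zpow_pos 𝒟.ρ_pos j
  exact ENNReal.toReal_le_of_le_ofReal (by positivity) (𝒟.diam_le j hj Q hQ)

theorem DyadicSystem.le_real_diam {j : ℤ} (hj : j ∈ 𝒟.J) {Q : Set (Heis n)} (hQ : Q ∈ 𝒟.gen j) :
    𝒟.D⁻¹ * 𝒟.ρ ^ j ≤ Metric.diam Q :=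
  (ENNReal.ofReal_le_iff_le_toReal
    (Metric.isBounded_iff_ediam_ne_top.1 (𝒟.isBounded_of_mem_cubes ⟨j, hj, hQ⟩))).1
    (𝒟.le_diam j hj Q hQ)

theorem DyadicSystem.diam_pos {Q : Set (Heis n)} (hQ : Q ∈ 𝒟.cubes) : 0 < Metric.diam Q := by
  obtain ⟨j, hj, hQ⟩ := hQ
  have h1 := 𝒟.one_lt_D
  have h2 := zpow_pos 𝒟.ρ_pos j
  exact lt_of_lt_of_le (by positivity) (𝒟.le_real_diam hj hQ)

theorem DyadicSystem.measurableSet_of_mem_cubes {Q : Set (Heis n)} (hQ : Q ∈ 𝒟.cubes) :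
    MeasurableSet Q := by
  obtain ⟨j, hj, hQ⟩ := hQ
  exact 𝒟.measurable j hj Q hQ

theorem DyadicSystem.nested_cubes {Q R : Set (Heis n)} (hQ : Q ∈ 𝒟.cubes) (hR : R ∈ 𝒟.cubes)
    (h : (Q ∩ R).Nonempty) : Q ⊆ R ∨ R ⊆ Q := by
  obtain ⟨i, hi, hQ⟩ := hQ
  obtain ⟨j, hj, hR⟩ := hR
  exact 𝒟.nested i hi j hj Q hQ R hR h

theorem DyadicSystem.diam_mono {Q R : Set (Heis n)} (hR : R ∈ 𝒟.cubes) (h : Q ⊆ R) :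
    Metric.diam Q ≤ Metric.diam R :=
  Metric.diam_mono h (𝒟.isBounded_of_mem_cubes hR)

theorem DyadicSystem.mem_J_of_le {i j : ℤ} (hi : i ∈ 𝒟.J) (hij : i ≤ j) : j ∈ 𝒟.J := by
  by_cases hE : Bornology.IsBounded E
  · obtain ⟨J₀, -, -, hJ⟩ := 𝒟.J_of_bounded hE
    rw [hJ] at hi ⊢
    exact le_trans (mem_Ici.1 hi) hij
  · rw [𝒟.J_of_unbounded hE]; trivial

/-- Nested cubes with comparable diameters have comparable generations. A cube of a later
generation may contain a cube of an earlier one, so both inequalities carry information. -/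
theorem DyadicSystem.exists_generation_window (𝒟 : DyadicSystem k E) {K : ℝ} (hK : 1 ≤ K) :
    ∃ m : ℕ, ∀ i ∈ 𝒟.J, ∀ j ∈ 𝒟.J, ∀ R ∈ 𝒟.gen i, ∀ Q ∈ 𝒟.gen j, Q ⊆ R →
      Metric.diam R ≤ K * Metric.diam Q → i ≤ j + m ∧ j ≤ i + m := by
  have hD := 𝒟.one_lt_D
  have hρ := 𝒟.ρ_pos
  obtain ⟨m, hm⟩ := exists_pow_lt_of_lt_one (x := 1 / (K * 𝒟.D ^ 2)) (y := 𝒟.ρ) (by positivity)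
    𝒟.ρ_lt_one
  rw [lt_div_iff₀ (by positivity)] at hm
  refine ⟨m, fun i hi j hj R hR Q hQ hQR hd => ?_⟩
  have h1 := 𝒟.le_real_diam hi hR
  have h2 := 𝒟.real_diam_le hi hR
  have h3 := 𝒟.le_real_diam hj hQ
  have h4 := 𝒟.real_diam_le hj hQ
  have h5 := 𝒟.diam_mono ⟨i, hi, hR⟩ hQR
  rw [inv_mul_le_iff₀ (by positivity)] at h1 h3
  have hpi := zpow_pos hρ i
  have e1 : 𝒟.ρ ^ j ≤ K * 𝒟.D ^ 2 * 𝒟.ρ ^ i := by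
    calc 𝒟.ρ ^ j ≤ 𝒟.D * Metric.diam Q := h3
      _ ≤ 𝒟.D * (𝒟.D * 𝒟.ρ ^ i) := by gcongr; exact h5.trans h2
      _ = 1 * (𝒟.D ^ 2 * 𝒟.ρ ^ i) := by ring
      _ ≤ K * (𝒟.D ^ 2 * 𝒟.ρ ^ i) := by gcongr
      _ = _ := by ring
  have e2 : 𝒟.ρ ^ i ≤ K * 𝒟.D ^ 2 * 𝒟.ρ ^ j := by
    calc 𝒟.ρ ^ i ≤ 𝒟.D * Metric.diam R := h1
      _ ≤ 𝒟.D * (K * (𝒟.D * 𝒟.ρ ^ j)) := by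
          gcongr; exact hd.trans (by gcongr)
      _ = _ := by ring
  have key : ∀ a b : ℤ, 𝒟.ρ ^ b ≤ K * 𝒟.D ^ 2 * 𝒟.ρ ^ a → a ≤ b + m := by
    intro a b hab
    rw [← zpow_le_zpow_iff_right_of_lt_one₀ hρ 𝒟.ρ_lt_one, zpow_add₀ hρ.ne', zpow_natCast]
    have hpa := zpow_pos hρ a
    calc 𝒟.ρ ^ b * 𝒟.ρ ^ m ≤ K * 𝒟.D ^ 2 * 𝒟.ρ ^ a * 𝒟.ρ ^ m := by gcongr
      _ = 𝒟.ρ ^ m * (K * 𝒟.D ^ 2) * 𝒟.ρ ^ a := by ring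
      _ ≤ 1 * 𝒟.ρ ^ a := by gcongr
      _ = _ := one_mul _
  exact ⟨key i j e1, key j i e2⟩

/-- A family of disjoint cubes inside `R` has total measure at most that of `R`. -/
theorem tsum_measure_le_of_disjoint {P : Set (Set (Heis n))} {R : Set (Heis n)}
    (hP : P ⊆ 𝒟.cubes) (hd : P.PairwiseDisjoint id) (hR : ∀ Q ∈ P, Q ⊆ R) :
    ∑' Q : P, μH[(k : ℝ)] (Q : Set (Heis n)) ≤ μH[(k : ℝ)] R := by
  refine (tsum_meas_le_meas_iUnion_of_disjoint (As := fun Q : P => (Q : Set (Heis n))) _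
    (fun Q => 𝒟.measurableSet_of_mem_cubes (hP Q.2)) ?_).trans ?_
  · intro Q Q' h
    exact hd Q.2 Q'.2 (fun h' => h (Subtype.ext h'))
  · exact measure_mono (iUnion_subset fun Q => hR Q Q.2)

/-! ### Packing in a coronization -/

section Coronization

variable {C : ℝ} {good bad : Set (Set (Heis n))} {forest : Set (Set (Set (Heis n)))}

theorem IsCoronization.mem_cubes (h : IsCoronization 𝒟 C good bad forest)
    {S : Set (Set (Heis n))} (hS : S ∈ forest) {Q : Set (Heis n)} (hQ : Q ∈ S) : Q ∈ 𝒟.cubes :=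
  (h.coherent S hS).subset hQ

theorem IsCoronization.eq_of_mem (h : IsCoronization 𝒟 C good bad forest)
    {S S' : Set (Set (Heis n))} (hS : S ∈ forest) (hS' : S' ∈ forest) {Q : Set (Heis n)}
    (hQ : Q ∈ S) (hQ' : Q ∈ S') : S = S' := by
  by_contra hne
  exact disjoint_left.1 (h.forest_disjoint hS hS' hne) hQ hQ'

/-- A family of cubes that satisfies a packing condition inside every tree satisfies a packing
condition. A tree whose top is not contained in `R` and that has a cube inside `R` must contain `R`
itself, so there is at most one such tree. -/
theorem IsCoronization.packing_of_trees (h : IsCoronization 𝒟 C good bad forest)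
    {P : Set (Set (Heis n))} (hP : ∀ Q ∈ P, ∃ S ∈ forest, Q ∈ S) {N : ℝ≥0∞}
    (hN : ∀ S ∈ forest, ∀ R ∈ S, ∑' Q : {Q : Set (Heis n) | Q ∈ P ∧ Q ∈ S ∧ Q ⊆ R},
      μH[(k : ℝ)] (Q : Set (Heis n)) ≤ N * μH[(k : ℝ)] R) {R : Set (Heis n)} (hR : R ∈ 𝒟.cubes) :
    ∑' Q : {Q : Set (Heis n) | Q ∈ P ∧ Q ⊆ R}, μH[(k : ℝ)] (Q : Set (Heis n)) ≤
      (N * ENNReal.ofReal C + N) * μH[(k : ℝ)] R := by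
  let X : {S : Set (Set (Heis n)) // S ∈ forest ∧ treeTop S ⊆ R} → Set (Set (Heis n)) :=
    fun S => {Q | Q ∈ P ∧ Q ∈ S.1 ∧ Q ⊆ treeTop S.1}
  let Y : Set (Set (Heis n)) := {Q | Q ∈ P ∧ (∃ S ∈ forest, R ∈ S ∧ Q ∈ S) ∧ Q ⊆ R}
  have hsub : {Q : Set (Heis n) | Q ∈ P ∧ Q ⊆ R} ⊆ (⋃ S, X S) ∪ Y := by
    rintro Q ⟨hQP, hQR⟩
    obtain ⟨S, hS, hQS⟩ := hP Q hQP
    have hQc := h.mem_cubes hS hQS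
    have htop := (h.coherent S hS).top
    obtain ⟨x, hx⟩ := 𝒟.nonempty_of_mem_cubes hQc
    rcases 𝒟.nested_cubes (h.mem_cubes hS htop.1) hR ⟨x, htop.2 hQS hx, hQR hx⟩ with h1 | h1
    · exact Or.inl (mem_iUnion.2 ⟨⟨S, hS, h1⟩, hQP, hQS, htop.2 hQS⟩)
    · exact Or.inr ⟨hQP, ⟨S, hS, (h.coherent S hS).convex Q hQS R hR hQR h1, hQS⟩, hQR⟩
  have hY : ∑' Q : Y, μH[(k : ℝ)] (Q : Set (Heis n)) ≤ N * μH[(k : ℝ)] R := by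
    by_cases hex : ∃ S ∈ forest, R ∈ S
    · obtain ⟨S, hS, hRS⟩ := hex
      refine (ENNReal.tsum_mono_subtype (fun Q : Set (Heis n) => μH[(k : ℝ)] Q) ?_).trans
        (hN S hS R hRS)
      rintro Q ⟨hQP, ⟨S', hS', hRS', hQS'⟩, hQR⟩
      rw [h.eq_of_mem hS hS' hRS hRS']
      exact ⟨hQP, hQS', hQR⟩
    · have : Y = ∅ := by
        rw [eq_empty_iff_forall_notMem]
        rintro Q ⟨-, ⟨S, hS, hRS, -⟩, -⟩
        exact hex ⟨S, hS, hRS⟩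
      rw [this]
      simp
  calc _ ≤ ∑' Q : ↑((⋃ S, X S) ∪ Y), μH[(k : ℝ)] (Q : Set (Heis n)) :=
        ENNReal.tsum_mono_subtype (fun Q : Set (Heis n) => μH[(k : ℝ)] Q) hsub
    _ ≤ (∑' Q : ↑(⋃ S, X S), μH[(k : ℝ)] (Q : Set (Heis n))) +
          ∑' Q : Y, μH[(k : ℝ)] (Q : Set (Heis n)) :=
        ENNReal.tsum_union_le (fun Q : Set (Heis n) => μH[(k : ℝ)] Q) _ _
    _ ≤ (∑' S, ∑' Q : X S, μH[(k : ℝ)] (Q : Set (Heis n))) + N * μH[(k : ℝ)] R := by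
        gcongr
        exact ENNReal.tsum_iUnion_le_tsum (fun Q : Set (Heis n) => μH[(k : ℝ)] Q) X
    _ ≤ (∑' S : {S : Set (Set (Heis n)) // S ∈ forest ∧ treeTop S ⊆ R},
          N * μH[(k : ℝ)] (treeTop (S : Set (Set (Heis n))))) + N * μH[(k : ℝ)] R := by
        gcongr with S
        exact hN S.1 S.2.1 _ (h.coherent S.1 S.2.1).top.1
    _ ≤ N * (ENNReal.ofReal C * μH[(k : ℝ)] R) + N * μH[(k : ℝ)] R := by
        rw [ENNReal.tsum_mul_left]
        gcongr
        exact h.top_packing R hR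
    _ = _ := by ring

/-! ### Cutting off the tops of the trees -/

/-- The cubes of the tree `S` whose diameter is at most `1 / K` times that of the top cube. -/
def smallCubes (K : ℝ) (S : Set (Set (Heis n))) : Set (Set (Heis n)) :=
  {Q ∈ S | K * Metric.diam Q ≤ Metric.diam (treeTop S)}

theorem IsCoherent.exists_maximal_smallCube {S : Set (Set (Heis n))} (hS : IsCoherent 𝒟 S) {K : ℝ}
    {Q : Set (Heis n)} (hQ : Q ∈ smallCubes K S) :
    ∃ Q₀, Q ⊆ Q₀ ∧ Maximal (· ∈ smallCubes K S) Q₀ := by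
  obtain ⟨j, hj, hQj⟩ := hS.subset hQ.1
  have hQc : Q ∈ 𝒟.cubes := hS.subset hQ.1
  have hpos := 𝒟.diam_pos hQc
  obtain ⟨m, hm⟩ := 𝒟.exists_generation_window
    (le_max_left 1 (Metric.diam (treeTop S) / Metric.diam Q))
  -- only finitely many cubes of the tree contain `Q`, one of each generation
  have hfin : {R | R ∈ smallCubes K S ∧ Q ⊆ R}.Finite := by
    have hsub : {R | R ∈ smallCubes K S ∧ Q ⊆ R} ⊆
        ⋃ i ∈ Icc (j - m) (j + m), {R | i ∈ 𝒟.J ∧ R ∈ 𝒟.gen i ∧ Q ⊆ R} := by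
      rintro R ⟨hR, hQR⟩
      obtain ⟨i, hi, hRi⟩ := hS.subset hR.1
      have h1 : Metric.diam R ≤ max 1 (Metric.diam (treeTop S) / Metric.diam Q) *
          Metric.diam Q := by
        calc Metric.diam R ≤ Metric.diam (treeTop S) :=
              𝒟.diam_mono (hS.subset hS.top.1) (hS.top.2 hR.1)
          _ = Metric.diam (treeTop S) / Metric.diam Q * Metric.diam Q := by field_simp
          _ ≤ _ := by gcongr; exact le_max_right _ _
      have h2 := hm i hi j hj R hRi Q hQj hQR h1
      exact mem_iUnion₂.2 ⟨i, ⟨by linarith [h2.2], h2.1⟩, hi, hRi, hQR⟩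
    refine ((finite_Icc (j - (m : ℤ)) (j + m)).biUnion fun i _ => ?_).subset hsub
    refine Subsingleton.finite ?_
    rintro R ⟨hi, hR, hQR⟩ R' ⟨-, hR', hQR'⟩
    by_contra hne
    obtain ⟨x, hx⟩ := 𝒟.nonempty_of_mem_cubes hQc
    exact disjoint_left.1 (𝒟.pairwise_disjoint i hi hR hR' hne) (hQR hx) (hQR' hx)
  obtain ⟨Q₀, hQ₀, hmax⟩ := hfin.exists_le_maximal (a := Q) ⟨hQ, Subset.rfl⟩
  exact ⟨Q₀, hQ₀, hmax.prop.1, fun R hR hle => hmax.le_of_ge ⟨hR, hQ₀.trans hle⟩ hle⟩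

theorem IsCoherent.eq_of_maximal_smallCube {S : Set (Set (Heis n))} (hS : IsCoherent 𝒟 S) {K : ℝ}
    {Q R : Set (Heis n)} (hQ : Maximal (· ∈ smallCubes K S) Q)
    (hR : Maximal (· ∈ smallCubes K S) R) (h : (Q ∩ R).Nonempty) : Q = R := by
  rcases 𝒟.nested_cubes (hS.subset hQ.prop.1) (hS.subset hR.prop.1) h with h1 | h1
  · exact hQ.eq_of_subset hR.prop h1
  · exact (hR.eq_of_subset hQ.prop h1).symm

/-- The part of the tree `S` below the cube `Q`. -/
def subtree (S : Set (Set (Heis n))) (Q : Set (Heis n)) : Set (Set (Heis n)) := {R ∈ S | R ⊆ Q}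

theorem treeTop_subtree {S : Set (Set (Heis n))} {Q : Set (Heis n)} (hQ : Q ∈ S) :
    treeTop (subtree S Q) = Q :=
  treeTop_eq ⟨⟨hQ, Subset.rfl⟩, fun _ hR => hR.2⟩

theorem IsCoherent.subtree {S : Set (Set (Heis n))} (hS : IsCoherent 𝒟 S) {Q : Set (Heis n)}
    (hQ : Q ∈ S) : IsCoherent 𝒟 (subtree S Q) where
  subset _ hR := hS.subset hR.1
  top := by
    rw [treeTop_subtree hQ]
    exact ⟨⟨hQ, Subset.rfl⟩, fun _ hR => hR.2⟩
  convex P hP R hR hPR hRQ := by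
    rw [treeTop_subtree hQ] at hRQ
    exact ⟨hS.convex P hP.1 R hR hPR (hRQ.trans (hS.top.2 hQ)), hRQ⟩
  children j hj P hP hPS := by
    rcases hS.children j hj P hP hPS.1 with h | h
    · exact Or.inl fun R hR hRP => ⟨h R hR hRP, hRP.trans hPS.2⟩
    · exact Or.inr fun R hR hRP hRS => h R hR hRP hRS.1

/-- A coronization can be refined so that the top cube of every new tree is much smaller than the
top cube of the old tree containing it. The large cubes of each tree become bad cubes, and the
maximal small cubes become the new top cubes. -/
theorem IsCoronization.exists_refinement (h : IsCoronization 𝒟 C good bad forest) (hC : 0 < C)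
    {K : ℝ} (hK : 1 ≤ K) :
    ∃ C' : ℝ, 0 < C' ∧ ∃ (good' bad' : Set (Set (Heis n))) (forest' : Set (Set (Set (Heis n)))),
      IsCoronization 𝒟 C' good' bad' forest' ∧ ∀ T ∈ forest', ∃ S ∈ forest, T ⊆ S ∧
        treeTop T ∈ S ∧ K * Metric.diam (treeTop T) ≤ Metric.diam (treeTop S) := by
  obtain ⟨m, hm⟩ := 𝒟.exists_generation_window hK
  let large : Set (Set (Heis n)) :=
    {Q | ∃ S ∈ forest, Q ∈ S ∧ Metric.diam (treeTop S) < K * Metric.diam Q}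
  let tops : Set (Set (Heis n)) := {Q | ∃ S ∈ forest, Maximal (· ∈ smallCubes K S) Q}
  let forest' : Set (Set (Set (Heis n))) :=
    {T | ∃ S ∈ forest, ∃ Q, Maximal (· ∈ smallCubes K S) Q ∧ T = subtree S Q}
  have hlarge : ∀ S ∈ forest, ∀ R ∈ S, ∑' Q : {Q : Set (Heis n) | Q ∈ large ∧ Q ∈ S ∧ Q ⊆ R},
      μH[(k : ℝ)] (Q : Set (Heis n)) ≤ ((2 * m + 1 : ℕ) : ℝ≥0∞) * μH[(k : ℝ)] R := by
    intro S hS R hR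
    obtain ⟨i, hi, hRi⟩ := h.mem_cubes hS hR
    let t : ℤ → Set (Set (Heis n)) := fun j => {Q | j ∈ 𝒟.J ∧ Q ∈ 𝒟.gen j ∧ Q ⊆ R}
    have hsub : {Q : Set (Heis n) | Q ∈ large ∧ Q ∈ S ∧ Q ⊆ R} ⊆
        ⋃ j ∈ Finset.Icc (i - (m : ℤ)) (i + m), t j := by
      rintro Q ⟨⟨S', hS', hQS', hlt⟩, hQS, hQR⟩
      rw [h.eq_of_mem hS' hS hQS' hQS] at hlt
      obtain ⟨j, hj, hQj⟩ := h.mem_cubes hS hQS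
      have htop := (h.coherent S hS).top
      have hle := 𝒟.diam_mono (h.mem_cubes hS htop.1) (htop.2 hR)
      have h2 := hm i hi j hj R hRi Q hQj hQR (hle.trans hlt.le)
      refine mem_iUnion₂.2 ⟨j, Finset.mem_Icc.2 ⟨?_, h2.2⟩, hj, hQj, hQR⟩
      linarith [h2.1]
    calc _ ≤ ∑' Q : ↑(⋃ j ∈ Finset.Icc (i - (m : ℤ)) (i + m), t j),
            μH[(k : ℝ)] (Q : Set (Heis n)) :=
          ENNReal.tsum_mono_subtype (fun Q : Set (Heis n) => μH[(k : ℝ)] Q) hsub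
      _ ≤ ∑ j ∈ Finset.Icc (i - (m : ℤ)) (i + m), ∑' Q : t j, μH[(k : ℝ)] (Q : Set (Heis n)) :=
          ENNReal.tsum_biUnion_le (fun Q : Set (Heis n) => μH[(k : ℝ)] Q) _ t
      _ ≤ (Finset.Icc (i - (m : ℤ)) (i + m)).card • μH[(k : ℝ)] R := by
          refine Finset.sum_le_card_nsmul _ _ _ fun j _ => ?_
          refine tsum_measure_le_of_disjoint (𝒟 := 𝒟) (fun Q hQ => ⟨j, hQ.1, hQ.2.1⟩) ?_
            fun Q hQ => hQ.2.2
          intro Q hQ Q' hQ' hne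
          exact 𝒟.pairwise_disjoint j hQ.1 hQ.2.1 hQ'.2.1 hne
      _ = _ := by
          rw [nsmul_eq_mul, Int.card_Icc]
          congr 2
          omega
  have htops : ∀ S ∈ forest, ∀ R ∈ S, ∑' Q : {Q : Set (Heis n) | Q ∈ tops ∧ Q ∈ S ∧ Q ⊆ R},
      μH[(k : ℝ)] (Q : Set (Heis n)) ≤ 1 * μH[(k : ℝ)] R := by
    intro S hS R hR
    rw [one_mul]
    refine tsum_measure_le_of_disjoint (𝒟 := 𝒟) (fun Q hQ => h.mem_cubes hS hQ.2.1) ?_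
      fun Q hQ => hQ.2.2
    rintro Q ⟨⟨S₁, hS₁, hQ⟩, hQS, -⟩ Q' ⟨⟨S₂, hS₂, hQ'⟩, hQS', -⟩ hne
    obtain rfl := h.eq_of_mem hS₁ hS hQ.prop.1 hQS
    obtain rfl := h.eq_of_mem hS₂ hS hQ'.prop.1 hQS'
    by_contra hnd
    exact hne ((h.coherent _ hS₁).eq_of_maximal_smallCube hQ hQ'
      (not_disjoint_iff_nonempty_inter.1 hnd))
  have hforest : ∀ T ∈ forest', ∃ S ∈ forest, treeTop T ∈ S ∧ T = subtree S (treeTop T) ∧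
      Maximal (· ∈ smallCubes K S) (treeTop T) := by
    rintro T ⟨S, hS, Q, hQ, rfl⟩
    rw [treeTop_subtree hQ.prop.1]
    exact ⟨S, hS, hQ.prop.1, rfl, hQ⟩
  have hgood : ∀ Q, Q ∈ ⋃₀ forest' ↔ ∃ S ∈ forest, Q ∈ smallCubes K S := by
    intro Q
    constructor
    · rintro ⟨T, ⟨S, hS, Q₀, hQ₀, rfl⟩, hQT⟩
      refine ⟨S, hS, hQT.1, ?_⟩
      have := 𝒟.diam_mono (h.mem_cubes hS hQ₀.prop.1) hQT.2
      calc K * Metric.diam Q ≤ K * Metric.diam Q₀ := by gcongr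
        _ ≤ _ := hQ₀.prop.2
    · rintro ⟨S, hS, hQ⟩
      obtain ⟨Q₀, hQQ₀, hQ₀⟩ := (h.coherent S hS).exists_maximal_smallCube hQ
      exact ⟨_, ⟨S, hS, Q₀, hQ₀, rfl⟩, hQ.1, hQQ₀⟩
  set N : ℕ := 2 * m + 1 with hN
  have hCN : ENNReal.ofReal (C + (N * C + N)) =
      ENNReal.ofReal C + (N * ENNReal.ofReal C + N) := by
    rw [ENNReal.ofReal_add (by positivity) (by positivity),
      ENNReal.ofReal_add (by positivity) (by positivity), ENNReal.ofReal_mul (by positivity),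
      ENNReal.ofReal_natCast]
  refine ⟨C + (N * C + N), by positivity, ⋃₀ forest', bad ∪ large, forest', ?_, ?_⟩
  · refine ⟨?_, ?_, ?_, rfl, ?_, ?_, ?_⟩
    · apply Subset.antisymm
      · rintro Q (hQ | hQ | ⟨S, hS, hQS, -⟩)
        · obtain ⟨S, hS, hQ⟩ := (hgood Q).1 hQ
          exact h.mem_cubes hS hQ.1
        · rw [← h.union]; exact Or.inr hQ
        · exact h.mem_cubes hS hQS
      · intro Q hQ
        rw [← h.union] at hQ
        rcases hQ with hQ | hQ
        · rw [← h.forest_union] at hQ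
          obtain ⟨S, hS, hQS⟩ := hQ
          by_cases hd : K * Metric.diam Q ≤ Metric.diam (treeTop S)
          · exact Or.inl ((hgood Q).2 ⟨S, hS, hQS, hd⟩)
          · exact Or.inr (Or.inr ⟨S, hS, hQS, not_le.1 hd⟩)
        · exact Or.inr (Or.inl hQ)
    · rw [disjoint_left]
      intro Q hQ hQ'
      obtain ⟨S, hS, hQS, hd⟩ := (hgood Q).1 hQ
      rcases hQ' with hQ' | ⟨S', hS', hQS', hd'⟩
      · refine disjoint_left.1 h.disjoint ?_ hQ'
        rw [← h.forest_union]
        exact ⟨S, hS, hQS⟩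
      · obtain rfl := h.eq_of_mem hS hS' hQS hQS'
        exact absurd hd (not_le.2 hd')
    · intro R hR
      have hsub : {Q : Set (Heis n) | Q ∈ bad ∪ large ∧ Q ⊆ R} ⊆
          {Q | Q ∈ bad ∧ Q ⊆ R} ∪ {Q | Q ∈ large ∧ Q ⊆ R} := by
        rintro Q ⟨hQ | hQ, hQR⟩
        · exact Or.inl ⟨hQ, hQR⟩
        · exact Or.inr ⟨hQ, hQR⟩
      calc _ ≤ ∑' Q : ↑({Q | Q ∈ bad ∧ Q ⊆ R} ∪ {Q | Q ∈ large ∧ Q ⊆ R}),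
              μH[(k : ℝ)] (Q : Set (Heis n)) :=
            ENNReal.tsum_mono_subtype (fun Q : Set (Heis n) => μH[(k : ℝ)] Q) hsub
        _ ≤ _ := ENNReal.tsum_union_le (fun Q : Set (Heis n) => μH[(k : ℝ)] Q) _ _
        _ ≤ ENNReal.ofReal C * μH[(k : ℝ)] R +
              (N * ENNReal.ofReal C + N) * μH[(k : ℝ)] R := by
            refine add_le_add (h.bad_packing R hR) ?_
            exact h.packing_of_trees (P := large) (fun Q ⟨S, hS, hQS, _⟩ => ⟨S, hS, hQS⟩)
              hlarge hR
        _ = _ := by rw [hCN]; ring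
    · intro T₁ hT₁ T₂ hT₂ hne
      obtain ⟨S₁, hS₁, ht₁, he₁, hm₁⟩ := hforest T₁ hT₁
      obtain ⟨S₂, hS₂, ht₂, he₂, hm₂⟩ := hforest T₂ hT₂
      change Disjoint T₁ T₂
      rw [disjoint_left]
      intro Q hQ₁ hQ₂
      rw [he₁] at hQ₁
      rw [he₂] at hQ₂
      obtain rfl := h.eq_of_mem hS₁ hS₂ hQ₁.1 hQ₂.1
      obtain ⟨x, hx⟩ := 𝒟.nonempty_of_mem_cubes (h.mem_cubes hS₁ hQ₁.1)
      have := (h.coherent _ hS₁).eq_of_maximal_smallCube hm₁ hm₂ ⟨x, hQ₁.2 hx, hQ₂.2 hx⟩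
      exact hne (by rw [he₁, he₂, this])
    · rintro T ⟨S, hS, Q, hQ, rfl⟩
      exact (h.coherent S hS).subtree hQ.prop.1
    · intro R hR
      let f : {S : Set (Set (Heis n)) // S ∈ forest' ∧ treeTop S ⊆ R} →
          {Q : Set (Heis n) | Q ∈ tops ∧ Q ⊆ R} := fun T => ⟨treeTop T.1, by
        obtain ⟨S, hS, -, -, hmax⟩ := hforest T.1 T.2.1
        exact ⟨⟨S, hS, hmax⟩, T.2.2⟩⟩
      have hf : Function.Injective f := by
        rintro ⟨T₁, hT₁, _⟩ ⟨T₂, hT₂, _⟩ heq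
        have heq' : treeTop T₁ = treeTop T₂ := congrArg Subtype.val heq
        obtain ⟨S₁, hS₁, ht₁, he₁, -⟩ := hforest T₁ hT₁
        obtain ⟨S₂, hS₂, ht₂, he₂, -⟩ := hforest T₂ hT₂
        rw [← heq'] at ht₂
        obtain rfl := h.eq_of_mem hS₁ hS₂ ht₁ ht₂
        refine Subtype.ext ?_
        change T₁ = T₂
        rw [he₁, he₂, heq']
      calc _ ≤ ∑' Q : {Q : Set (Heis n) | Q ∈ tops ∧ Q ⊆ R}, μH[(k : ℝ)] (Q : Set (Heis n)) :=
            ENNReal.tsum_comp_le_tsum_of_injective hf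
              (fun Q : {Q : Set (Heis n) | Q ∈ tops ∧ Q ⊆ R} =>
                μH[(k : ℝ)] (Q : Set (Heis n)))
        _ ≤ (1 * ENNReal.ofReal C + 1) * μH[(k : ℝ)] R :=
            h.packing_of_trees (P := tops) (fun Q ⟨S, hS, hQ⟩ => ⟨S, hS, hQ.prop.1⟩) htops hR
        _ ≤ _ := by
            have h1 : (1 : ℝ≥0∞) ≤ N := by rw [hN]; exact_mod_cast Nat.le_add_left 1 (2 * m)
            rw [hCN]
            refine mul_le_mul_left ?_ _
            calc (1 * ENNReal.ofReal C + 1 : ℝ≥0∞) ≤ N * ENNReal.ofReal C + N := by gcongr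
              _ ≤ _ := le_add_self
  · intro T hT
    obtain ⟨S, hS, ht, he, hmax⟩ := hforest T hT
    refine ⟨S, hS, ?_, ht, hmax.prop.2⟩
    rw [he]
    exact fun Q hQ => hQ.1

end Coronization

/-- Above a cube of diameter less than `T`, a tree has a cube of diameter comparable to `T`, unless
the top of the tree is smaller than that. -/
theorem IsCoherent.exists_ancestor {S : Set (Set (Heis n))} (hS : IsCoherent 𝒟 S)
    {Q : Set (Heis n)} (hQ : Q ∈ S) {T : ℝ} (hT : 0 < T) (hQT : Metric.diam Q < T) :
    ∃ R ∈ S, Q ⊆ R ∧ Metric.diam R ≤ 𝒟.D ^ 2 / 𝒟.ρ * T ∧ (R = treeTop S ∨ T ≤ Metric.diam R) := by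
  by_cases hlarge : Metric.diam (treeTop S) ≤ 𝒟.D ^ 2 / 𝒟.ρ * T
  · exact ⟨treeTop S, hS.top.1, hS.top.2 hQ, hlarge, Or.inl rfl⟩
  rw [not_le] at hlarge
  have hD := 𝒟.one_lt_D
  have hρ := 𝒟.ρ_pos
  have htopc : treeTop S ∈ 𝒟.cubes := hS.subset hS.top.1
  obtain ⟨j₀, hj₀, htop⟩ := hS.subset hS.top.1
  -- the last generation whose cubes all have diameter at least `T`
  obtain ⟨i, hi1, hi2⟩ : ∃ i : ℤ, 𝒟.ρ ^ (i + 1) < 𝒟.D * T ∧ 𝒟.D * T ≤ 𝒟.ρ ^ i := by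
    obtain ⟨p, hp1, hp2⟩ := exists_mem_Ioc_zpow (x := 𝒟.D * T) (y := 𝒟.ρ⁻¹) (by positivity)
      ((one_lt_inv₀ hρ).2 𝒟.ρ_lt_one)
    rw [inv_zpow'] at hp1 hp2
    refine ⟨-(p + 1), ?_, hp2⟩
    rwa [show -(p + 1) + 1 = -p by ring]
  have hi3 : 𝒟.ρ ^ i < 𝒟.D * T / 𝒟.ρ := by
    rw [zpow_add_one₀ hρ.ne'] at hi1
    rwa [lt_div_iff₀ hρ]
  have hiJ : i ∈ 𝒟.J := by
    refine 𝒟.mem_J_of_le hj₀ ?_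
    have h1 := 𝒟.real_diam_le hj₀ htop
    have h2 : 𝒟.ρ ^ i < 𝒟.ρ ^ j₀ := by
      refine lt_of_mul_lt_mul_left ?_ (zero_le_one.trans hD.le)
      calc 𝒟.D * 𝒟.ρ ^ i < 𝒟.D * (𝒟.D * T / 𝒟.ρ) := by gcongr
        _ = 𝒟.D ^ 2 / 𝒟.ρ * T := by ring
        _ < _ := hlarge.trans_le h1
    exact ((zpow_lt_zpow_iff_right_of_lt_one₀ hρ 𝒟.ρ_lt_one).1 h2).le
  have hQc := hS.subset hQ
  obtain ⟨x, hx⟩ := 𝒟.nonempty_of_mem_cubes hQc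
  obtain ⟨R, hR, hxR⟩ : x ∈ ⋃₀ 𝒟.gen i := by
    rw [𝒟.cover i hiJ]; exact 𝒟.subset_of_mem_cubes hQc hx
  have hRc : R ∈ 𝒟.cubes := ⟨i, hiJ, hR⟩
  have hRT : T ≤ Metric.diam R := by
    refine le_trans ?_ (𝒟.le_real_diam hiJ hR)
    rw [le_inv_mul_iff₀ (by positivity)]
    exact hi2
  have hRle : Metric.diam R < 𝒟.D ^ 2 / 𝒟.ρ * T := by
    calc Metric.diam R ≤ 𝒟.D * 𝒟.ρ ^ i := 𝒟.real_diam_le hiJ hR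
      _ < 𝒟.D * (𝒟.D * T / 𝒟.ρ) := by gcongr
      _ = _ := by ring
  have hQR : Q ⊆ R := by
    rcases 𝒟.nested_cubes hQc hRc ⟨x, hx, hxR⟩ with h | h
    · exact h
    · have := 𝒟.diam_mono hQc h
      linarith
  have hRtop : R ⊆ treeTop S := by
    rcases 𝒟.nested_cubes hRc htopc ⟨x, hxR, hS.top.2 hQ hx⟩ with h | h
    · exact h
    · have := 𝒟.diam_mono hRc h
      linarith
  exact ⟨R, hS.convex Q hQ R hRc hQR hRtop, hQR, hRle.le, Or.inr hRT⟩

/-! ### The two implications -/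

theorem treeDist_nonneg (S : Set (Set (Heis n))) (x : Heis n) : 0 ≤ treeDist S x :=
  Real.iInf_nonneg fun _ => add_nonneg Metric.infDist_nonneg Metric.diam_nonneg

theorem treeDist_le {S : Set (Set (Heis n))} {Q : Set (Heis n)} (hQ : Q ∈ S) (x : Heis n) :
    treeDist S x ≤ Metric.infDist x Q + Metric.diam Q :=
  ciInf_le (f := fun Q : S => Metric.infDist x (Q : Set (Heis n)) + Metric.diam (Q : Set (Heis n)))
    ⟨0, by rintro _ ⟨Q, rfl⟩; exact add_nonneg Metric.infDist_nonneg Metric.diam_nonneg⟩ ⟨Q, hQ⟩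

/-- The graph of a tree is an extension of a net in the neighbourhood of the top cube that is
separated and dense at the scale of the distance function of the tree. -/
theorem CoronaPlanes.coronaILG {K₀ : ℝ} (hK₀ : 2 ≤ K₀) (h : CoronaPlanes k K₀ E 𝒟) :
    CoronaILG k E 𝒟 := by
  intro L hL
  obtain ⟨η₁, hη₁, hext⟩ := exists_intrinsicLipschitzGraph_superset k hL
  set η := min η₁ (L / 2) with hη
  have hη0 : 0 < η := lt_min hη₁ (by positivity)
  obtain ⟨C, hC, good, bad, forest, hcor, hplanes⟩ := h η hη0
  refine ⟨C, hC, good, bad, forest, hcor, fun S hS => ?_⟩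
  obtain ⟨p, V, hV, hpl⟩ := hplanes S hS
  have hcoh := hcor.coherent S hS
  have htopc : treeTop S ∈ 𝒟.cubes := hcoh.subset hcoh.top.1
  obtain ⟨N, hNsub, hNsep, hNnet⟩ := exists_separated_net (enlarge E K₀ (treeTop S))
    (fun x => η * treeDist S x) (fun x => mul_nonneg hη0.le (treeDist_nonneg S x))
  have hNne : N.Nonempty := by
    obtain ⟨x, hx⟩ := 𝒟.nonempty_of_mem_cubes htopc
    obtain ⟨y, hy, -⟩ := hNnet x ⟨𝒟.subset_of_mem_cubes htopc hx, by
      rw [Metric.infDist_zero_of_mem hx]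
      exact mul_nonneg (by linarith) Metric.diam_nonneg⟩
    exact ⟨y, hy⟩
  obtain ⟨Γ, hΓ, hNΓ⟩ := hext n V hV N hNne (by
    intro x hx y hy
    by_cases hxy : x = y
    · subst hxy; simp
    have hsep := hNsep x hx y hy hxy
    rw [← mul_min_of_nonneg _ _ hη0.le] at hsep
    have := hpl x (hNsub hx) y (hNsub hy) hsep
    rw [dist_projAffine hV] at this
    refine this.trans ?_
    gcongr
    exact min_le_left _ _)
  refine ⟨Γ, hΓ, fun Q hQ x hx hxQ => ?_⟩
  have hQc : Q ∈ 𝒟.cubes := hcoh.subset hQ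
  have hxmem : x ∈ enlarge E K₀ (treeTop S) := by
    refine ⟨hx, ?_⟩
    have h1 := Metric.infDist_le_infDist_of_subset (x := x) (hcoh.top.2 hQ)
      (𝒟.nonempty_of_mem_cubes hQc)
    have h2 := 𝒟.diam_mono htopc (hcoh.top.2 hQ)
    have h3 : 1 * Metric.diam (treeTop S) ≤ (K₀ - 1) * Metric.diam (treeTop S) := by
      have : 0 ≤ Metric.diam (treeTop S) := Metric.diam_nonneg
      gcongr; linarith
    linarith
  obtain ⟨y, hyN, hy⟩ := hNnet x hxmem
  calc Metric.infDist x Γ ≤ dist x y := Metric.infDist_le_dist_of_mem (hNΓ hyN)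
    _ ≤ η * treeDist S x := hy.trans (min_le_left _ _)
    _ ≤ η * (Metric.diam Q + Metric.diam Q) := by
        gcongr
        exact (treeDist_le hQ x).trans (by gcongr)
    _ = 2 * η * Metric.diam Q := by ring
    _ ≤ L * Metric.diam Q := by
        have : 0 ≤ Metric.diam Q := Metric.diam_nonneg
        gcongr
        have : η ≤ L / 2 := min_le_right _ _
        linarith

/-- The projection to the horizontal subgroup of a flat intrinsic Lipschitz graph almost preserves
the distance of two points that are close to the graph relative to their distance. -/
theorem dist_le_of_infDist_graph_le {V : Submodule ℝ (EuclideanSpace ℝ (Fin n ⊕ Fin n))}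
    {η L τ : ℝ} (hη : 0 < η) (hη1 : η ≤ 1) (hLη : L ≤ η / 4)
    (hτ : 0 < τ) (hτη : τ ≤ η / 48) {φ : horizontalSubgroup V → verticalSubgroup V}
    (hφ : IntrinsicLipschitzWith L φ) (hne : (range (graphMap φ)).Nonempty) {x y : Heis n}
    (hxy : 0 < dist x y)
    (hx : Metric.infDist x (range (graphMap φ)) ≤ τ * dist x y)
    (hy : Metric.infDist y (range (graphMap φ)) ≤ τ * dist x y) :
    dist x y ≤ (1 + 2 * η) * ‖V.starProjection (x.z - y.z)‖ := by
  have hτd : 0 < τ * dist x y := by positivity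
  obtain ⟨_, ⟨v, rfl⟩, hv⟩ := (Metric.infDist_lt_iff hne).1
    (lt_of_le_of_lt hx (show _ < 2 * (τ * dist x y) by linarith))
  obtain ⟨_, ⟨v', rfl⟩, hv'⟩ := (Metric.infDist_lt_iff hne).1
    (lt_of_le_of_lt hy (show _ < 2 * (τ * dist x y) by linarith))
  set a := graphMap φ v
  set b := graphMap φ v'
  have h1 : dist a b ≤ (1 + L) * ‖V.starProjection (a.z - b.z)‖ := by
    have h2 := koranyi_le_projH_add_projW (V := V) (b⁻¹ * a)
    have h3 : koranyi (projW V (b⁻¹ * a)) ≤ L * koranyi (projH V (b⁻¹ * a)) := hφ v v'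
    rw [koranyi_projH, inv_mul_z] at h2 h3
    rw [dist_def]
    linarith
  have h4 : ‖V.starProjection (a.z - b.z)‖ ≤
      ‖V.starProjection (x.z - y.z)‖ + 4 * (τ * dist x y) := by
    have e : a.z - b.z = (x.z - y.z) - (x.z - a.z) + (y.z - b.z) := by abel
    rw [e, map_add, map_sub]
    have h5 := (V.norm_starProjection_apply_le (x.z - a.z)).trans (norm_z_sub_le_dist x a)
    have h6 := (V.norm_starProjection_apply_le (y.z - b.z)).trans (norm_z_sub_le_dist y b)
    refine (norm_add_le _ _).trans ?_
    have := norm_sub_le (V.starProjection (x.z - y.z)) (V.starProjection (x.z - a.z))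
    linarith
  have h7 : dist x y ≤ dist a b + 4 * (τ * dist x y) := by
    have := dist_triangle4 x a b y
    rw [dist_comm b y] at this
    linarith
  set d := dist x y
  set P := ‖V.starProjection (x.z - y.z)‖
  have hP : 0 ≤ P := norm_nonneg _
  have h8 : d ≤ (1 + η / 4) * (P + 4 * (τ * d)) + 4 * (τ * d) := by
    have h9 : (1 + L) * ‖V.starProjection (a.z - b.z)‖ ≤ (1 + η / 4) * (P + 4 * (τ * d)) := by
      gcongr
    linarith
  have h10 : τ * d ≤ η / 48 * d := by gcongr
  have h11 : (1 - η / 4) * d ≤ (1 + η / 4) * P := by nlinarith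
  have h12 : (1 + η / 4) * P ≤ (1 + 2 * η) * (1 - η / 4) * P := by
    gcongr
    nlinarith
  have h13 : 0 < 1 - η / 4 := by linarith
  refine le_of_mul_le_mul_left ?_ h13
  linarith

/-- The plane of a tree is the horizontal subgroup over which the graph of the tree is defined. The
tops of the trees are cut off, so that every point of the enlarged top cube of a new tree is close
to the graph at some scale of the old tree. -/
theorem CoronaILG.coronaPlanes {K₀ : ℝ} (hK₀ : 2 ≤ K₀) (h : CoronaILG k E 𝒟) :
    CoronaPlanes k K₀ E 𝒟 := by
  intro η₀ hη₀
  set η := min η₀ 1 with hη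
  have hη0 : 0 < η := lt_min hη₀ one_pos
  have hη1 : η ≤ 1 := min_le_right _ _
  have hηle : η ≤ η₀ := min_le_left _ _
  have hD := 𝒟.one_lt_D
  have hρ := 𝒟.ρ_pos
  set c := 𝒟.D ^ 2 / 𝒟.ρ with hc
  have hc1 : 1 ≤ c := by
    rw [hc, one_le_div hρ]
    have := 𝒟.ρ_lt_one
    nlinarith
  -- a cube of diameter at most `2 c d(x, y) / η` is as close to its graph as needed
  set L := η ^ 2 / (96 * c) with hL
  have hL0 : 0 < L := by positivity
  have hLη : L ≤ η / 4 := by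
    rw [hL, div_le_iff₀ (by positivity)]
    nlinarith
  obtain ⟨C, hC, good, bad, forest, hcor, hgraph⟩ := h L hL0
  obtain ⟨C', hC', good', bad', forest', hcor', hsub⟩ :=
    hcor.exists_refinement hC (K := K₀ - 1) (by linarith)
  refine ⟨C', hC', good', bad', forest', hcor', fun T hT => ?_⟩
  obtain ⟨S, hS, hTS, htopS, htop⟩ := hsub T hT
  obtain ⟨Γ, ⟨V, hV, φ, hφ, rfl⟩, hΓ⟩ := hgraph S hS
  have hcoh := hcor.coherent S hS
  have hcohT := hcor'.coherent T hT
  have hne : (range (graphMap φ)).Nonempty := ⟨_, ⟨⟨1, V.zero_mem, rfl⟩, rfl⟩⟩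
  have hTne : Nonempty T := ⟨⟨_, hcohT.top.1⟩⟩
  have key : ∀ x ∈ enlarge E K₀ (treeTop T), ∀ y ∈ enlarge E K₀ (treeTop T),
      η * treeDist T x < dist x y → dist x y ≤ (1 + 2 * η) * ‖V.starProjection (x.z - y.z)‖ := by
    intro x hx y hy hxy
    have hd : 0 < dist x y :=
      lt_of_le_of_lt (mul_nonneg hη0.le (treeDist_nonneg T x)) hxy
    rw [mul_comm, ← lt_div_iff₀ hη0] at hxy
    obtain ⟨⟨Q, hQ⟩, hQlt⟩ := exists_lt_of_ciInf_lt hxy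
    simp only at hQlt
    set M := dist x y / η with hM
    have hM0 : 0 < M := by positivity
    have hMd : dist x y ≤ M := by
      rw [hM, le_div_iff₀ hη0]
      nlinarith
    have hi0 : 0 ≤ Metric.infDist x Q := Metric.infDist_nonneg
    have hd0 : 0 ≤ Metric.diam Q := Metric.diam_nonneg
    obtain ⟨R, hR, hQR, hRle, hRtop⟩ := hcoh.exists_ancestor (hTS hQ) (T := 2 * M) (by positivity)
      (by linarith)
    have hQne := 𝒟.nonempty_of_mem_cubes (hcoh.subset (hTS hQ))
    have hclose : ∀ u ∈ enlarge E K₀ (treeTop T), Metric.infDist u Q ≤ 2 * M →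
        Metric.infDist u (range (graphMap φ)) ≤ η / 48 * dist x y := by
      intro u hu huQ
      have huR : Metric.infDist u R ≤ Metric.diam R := by
        rcases hRtop with rfl | hRM
        · have h1 := Metric.infDist_le_infDist_of_subset (x := u) (hcoh.top.2 htopS)
            (𝒟.nonempty_of_mem_cubes (hcohT.subset hcohT.top.1))
          linarith [hu.2]
        · have h1 := Metric.infDist_le_infDist_of_subset (x := u) hQR hQne
          linarith
      calc _ ≤ L * Metric.diam R := hΓ R hR u hu.1 huR
        _ ≤ L * (c * (2 * M)) := by gcongr
        _ = η / 48 * dist x y := by rw [hL, hM]; field_simp; norm_num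
    refine dist_le_of_infDist_graph_le hη0 hη1 hLη (τ := η / 48) (by positivity) le_rfl hφ hne hd
      (hclose x hx (by linarith)) (hclose y hy ?_)
    have h1 : Metric.infDist y Q ≤ Metric.infDist x Q + dist y x :=
      Metric.infDist_le_infDist_add_dist
    rw [dist_comm y x] at h1
    linarith
  refine ⟨1, V, hV, fun x hx y hy hxy => ?_⟩
  rw [dist_projAffine hV]
  have hle : dist x y ≤ (1 + 2 * η) * ‖V.starProjection (x.z - y.z)‖ := by
    have hxy' : η * min (treeDist T x) (treeDist T y) < dist x y := by
      refine lt_of_le_of_lt ?_ hxy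
      gcongr
      exact le_min (treeDist_nonneg T x) (treeDist_nonneg T y)
    rcases min_choice (treeDist T x) (treeDist T y) with hm | hm
    · rw [hm] at hxy'
      exact key x hx y hy hxy'
    · rw [hm, dist_comm] at hxy'
      have := key y hy x hx hxy'
      rwa [dist_comm, ← neg_sub, map_neg, norm_neg] at this
  exact hle.trans (by gcongr)

end Heis

theorem theorem1p6 (n k : ℕ) (hk : 1 ≤ k) (hkn : k ≤ n) (E : Set (Heis n))
    (hE : Heis.IsRegular (k : ℝ) E) (𝒟 : Heis.DyadicSystem k E) (K₀ : ℝ) (hK₀ : 2 ≤ K₀) :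
    Heis.CoronaPlanes k K₀ E 𝒟 ↔ Heis.CoronaILG k E 𝒟 :=
  ⟨fun h => h.coronaILG hK₀, fun h => h.coronaPlanes hK₀⟩
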